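/- A binary constraint satisfaction problem $P=(N,D,C)$ has a finite set $N$ of $n$ variables, a finite domain $D_i$ for every variable $i$, and a set $C$ of $e$ constraints, at most one on each pair of distinct variables; the constraint $c_{ij}$ on $\{i,j\}$ is a set of allowed pairs in $D_i\times D_j$, and $(a,b)\in c_{ij}$ iff $(b,a)\in c_{ji}$. Let $d=\max_i|D_i|$. The constraint $c_{ij}$ is functional on $j$ if every $a\in D_i$ is compatible with at most one $b\in D_j$. Let $P^F$ be the directed graph on $N$ with an edge $(i,j)$ whenever $c_{ij}\in C$ is functional on $j$. A functional elimination ordering is a sequence listing every variable once such that, whenever $i$ stands before $j$ and there is a path of $P^F$ from $i$ to $j$ or from $j$ to $i$, there is a path from $i$ to $j$. The algorithm Linear_Elimination works as follows. 1. Determine which constraints are functional, and find a functional elimination ordering $O$: list the strongly connected components of $P^F$ in a topological order of the condensed graph, and replace every component by a sequence of its vertices. (The components and their topological order are found by a depth-first search of $P^F$ followed by a search of the reversed graph in decreasing order of finishing times.) 2. Let $C^0$ be the initial $C$, and mark all variables as not eliminated. Go through the variables $i$ in the order $O$. If $i$ is not marked as eliminated, let $L$ be the set of all $j$ with $c_{ij}\in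 C$ such that $c^0_{ij}\in C^0$ is functional on $j$. While $L\neq\emptyset$, take and delete some $j$ from $L$; for every $c_{jk}\in C$ with $k\ne i$, replace $c_{jk}$ by $c'_{ik}=c_{ik}\cap(c_{jk}\circ c_{ij})$ (where $c_{ik}=D_i\times D_k$ if there is no constraint on $\{i,k\}$, and $c_{jk}\circ c_{ij}=\{(a,c) : \exists b\in D_j,\ (a,b)\in c_{ij},\ (b,c)\in c_{jk}\}$, computed by looking up, for each $a\in D_i$, its support in $D_j$), and put $k$ into $L$ if $c^0_{jk}\in C^0$ is functional on $k$; then mark $j$ as eliminated. Elementary steps are: a test of a tuple, reading or writing a tuple of the constraint on a given pair, testing, reading, inserting or deleting one element of a list, array or set; copying or initialising a list, array or set costs its length. **Theorem.** For every constant $\kappa$ there is a constant $K$ such that for every problem $P$ with $e\ge1$, $d\ge1$ and $n\le\kappa e$ (for instance $\kappa=2$ if every variable occurs in a constraint), and for every way of resolving the choices left open by the algorithm (the order in which elements of sets are taken): (a) Linear_Elimination terminates after at most $K\,e\,d^2$ elementary steps, so its worst-case running time is $O(ed^2)$; (b) step 1 terminates within $K\,e\,d^2$ elementary steps, leaves the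 problem unchanged, and produces a functional elimination ordering of $P$, which is a concatenation of the strongly connected components of $P^F$ in a topological order; (c) step 2, started from $P$ with an arbitrary functional elimination ordering of $P$, terminates within $K\,e\,d^2$ elementary steps. -/

import Mathlib

/-! ## Binary constraint satisfaction problems -/

/-- A binary CSP on the variables `V` with values in `U`.  The variable `i` has the finite domain
`D i`.  The pair `{i, j}` carries a constraint iff it is an edge of the constraint graph `G` (so
there is at most one constraint on a pair), and the allowed tuples are then given by `c i j`,
restricted to `D i × D j`.  Off the edges of `G` the value of `c` has no meaning. -/
structure CSP (V U : Type) where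
  D : V → Finset U
  G : SimpleGraph V
  c : V → V → U → U → Prop
  c_symm : ∀ i j a b, c i j a b ↔ c j i b a

namespace CSP

variable {V U : Type}

/-- The number of constraints. -/
noncomputable def e (P : CSP V U) : ℕ := P.G.edgeSet.ncard

/-- The size of the largest domain. -/
def d [Fintype V] (P : CSP V U) : ℕ := Finset.univ.sup fun i => (P.D i).card

/-- The edges of the directed graph `P^F`: there is a constraint `c_ij` in `P`, and it is functional
on `j`, i.e. every value of `i` is compatible with at most one value of `j`. -/
def Functional (P : CSP V U) (i j : V) : Prop :=
  P.G.Adj i j ∧ ∀ a ∈ P.D i, ∀ b ∈ P.D j, ∀ b' ∈ P.D j, P.c i j a b → P.c i j a b' → b = b'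

/-- There is a (possibly empty) directed path from `i` to `j` in `P^F`. -/
def Path (P : CSP V U) (i j : V) : Prop := Relation.ReflTransGen P.Functional i j

/-- A sequence of all the variables, each listed once, such that if `i` stands before `j` and the
two are joined by a path of `P^F` in either direction, then there is a path from `i` to `j`. -/
def IsFunctionalEliminationOrdering (P : CSP V U) (O : List V) : Prop :=
  O.Nodup ∧ (∀ v, v ∈ O) ∧ O.Pairwise fun i j => (P.Path i j ∨ P.Path j i) → P.Path i j

/-- `O` is obtained by listing the strongly connected components of `P^F` in a topological order of
the condensed graph, and replacing every component by a sequence of its vertices. -/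
def IsTopologicalSequenceOfSCCs (P : CSP V U) (O : List V) : Prop :=
  O.Nodup ∧ (∀ v, v ∈ O) ∧ ∃ S : List (List V), O = S.flatten ∧
    (∀ K ∈ S, K ≠ [] ∧ ∀ u ∈ K, ∀ v, v ∈ K ↔ P.Path u v ∧ P.Path v u) ∧
    S.Pairwise fun K K' => ∀ u ∈ K, ∀ v ∈ K', ¬ P.Path v u

end CSP

/-! ## Nondeterministic imperative programs with a step count -/

/-- Imperative programs on memories of type `σ`. A primitive `prim w R` moves from `s` to any `s'`
with `R s s'`, at the cost `1 + w s`. -/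
inductive Cmd (σ : Type) : Type
  | skip : Cmd σ
  | prim (w : σ → ℕ) (R : σ → σ → Prop) : Cmd σ
  | seq (p q : Cmd σ) : Cmd σ
  | cond (b : σ → Prop) (p q : Cmd σ) : Cmd σ
  | loop (b : σ → Prop) (p : Cmd σ) : Cmd σ

namespace Cmd

variable {σ α : Type}

/-- `Step x t y`: one step from the configuration `x` to `y`, of cost `t`. A configuration consists
of the commands that are still to be executed and the memory. -/
inductive Step : List (Cmd σ) × σ → ℕ → List (Cmd σ) × σ → Prop
  | skip {r s} : Step (skip :: r, s) 1 (r, s)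
  | prim {w R r s s'} : R s s' → Step (prim w R :: r, s) (1 + w s) (r, s')
  | seq {p q r s} : Step (seq p q :: r, s) 1 (p :: q :: r, s)
  | cond_true {b p q r s} : b s → Step (cond b p q :: r, s) 1 (p :: r, s)
  | cond_false {b p q r s} : ¬ b s → Step (cond b p q :: r, s) 1 (q :: r, s)
  | loop_true {b p r s} : b s → Step (loop b p :: r, s) 1 (p :: loop b p :: r, s)
  | loop_false {b p r s} : ¬ b s → Step (loop b p :: r, s) 1 (r, s)

/-- `Exec x t y`: a finite sequence of steps from `x` to `y`, of total cost `t`. -/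
inductive Exec : List (Cmd σ) × σ → ℕ → List (Cmd σ) × σ → Prop
  | refl (x) : Exec x 0 x
  | tail {x y z t u} : Exec x t y → Step y u z → Exec x (t + u) z

/-- Every execution of `p` from `s`, however its choices are made, costs at most `t`, never gets
stuck, and (as every step has positive cost) ends after finitely many steps; the final memory
satisfies `Q`. -/
def RunsWithin (p : Cmd σ) (s : σ) (t : ℕ) (Q : σ → Prop) : Prop :=
  ∀ r s' m, Exec ([p], s) m (r, s') →
    m ≤ t ∧ (r = [] → Q s') ∧ (r ≠ [] → ∃ u y, Step (r, s') u y)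

/-- An elementary assignment, of cost 1. -/
def act (f : σ → σ) : Cmd σ := prim (fun _ => 0) fun s s' => s' = f s

/-- A bulk assignment (copying a list, initialising an array) in which `w s` cells are written. -/
def bulk (w : σ → ℕ) (f : σ → σ) : Cmd σ := prim w fun s s' => s' = f s

/-- Choose an arbitrary element `x` of the set `S s`, and execute the assignment `put x`. -/
def pick (S : σ → Finset α) (put : α → σ → σ) : Cmd σ :=
  prim (fun _ => 0) fun s s' => ∃ x ∈ S s, s' = put x s

/-- Read the first entry `x` of the list `S s`, and execute the assignment `put x`. -/
def first (S : σ → List α) (put : α → σ → σ) : Cmd σ :=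
  prim (fun _ => 0) fun s s' => ∃ x, (S s).head? = some x ∧ s' = put x s

/-- Sequential composition of a list of commands. -/
def block : List (Cmd σ) → Cmd σ
  | [] => skip
  | p :: l => seq p (block l)

/-- One-armed conditional. -/
def when (b : σ → Prop) (p : Cmd σ) : Cmd σ := cond b p skip

/-- While the set `S` is nonempty, take an element of it and execute the body. The assignment `put`
has to delete the element that is taken. -/
def whileTake (S : σ → Finset α) (put : α → σ → σ) (l : List (Cmd σ)) : Cmd σ :=
  loop (fun s => (S s).Nonempty) (block (pick S put :: l))

end Cmd

/-! ## The algorithm `Linear_Elimination` -/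

/-- The memory of the algorithm. The current constraint on a pair, and the records attached to a
variable, are accessed directly. A set of variables or values is kept as a doubly linked list with
an entry of a table pointing to the cell of each element, so that testing emptiness or membership,
reading an entry, inserting and deleting one element are elementary operations; copying a whole set
is not. -/
structure Memory (V U : Type) where
  /-- The constraints of the current `C`: there is a constraint on `{i, j}` iff `j ∈ N i`. -/
  N : V → Finset V
  /-- The tuples of the current constraints. -/
  c : V → V → U → U → Prop
  /-- `j ∈ F i` iff there was a constraint `c⁰_ij` in the input, and it was functional on `j`. -/
  F : V → Finset V
  /-- The reversed edges of `F`. -/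
  B : V → Finset V
  /-- The elimination ordering. -/
  O : List V
  /-- The variables marked as eliminated. -/
  eliminated : Finset V
  L : Finset V
  i : V
  j : V
  k : V
  a : U
  b : U
  /-- The support of the value `a`, if there is one. -/
  sup : Option U
  cnt : ℕ
  flag : Bool
  todoV : Finset V
  todoN : Finset V
  todoA : Finset U
  todoB : Finset U
  visited : Finset V
  rest : V → Finset V
  stack : List V
  fin : List V

namespace Memory

variable {V U : Type}

/-- The memory holds the problem `P`. -/
def Holds (s : Memory V U) (P : CSP V U) : Prop :=
  (∀ i j, j ∈ s.N i ↔ P.G.Adj i j) ∧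
    ∀ i j, P.G.Adj i j → ∀ a ∈ P.D i, ∀ b ∈ P.D j, (s.c i j a b ↔ P.c i j a b)

/-- The functional constraints of `P` are recorded in the memory. -/
def RecordsFunctional (s : Memory V U) (P : CSP V U) : Prop :=
  ∀ i j, j ∈ s.F i ↔ P.Functional i j

end Memory

namespace LinearElimination

open Cmd

variable {V U : Type}

open scoped Classical in
/-- Set the flag iff the constraint `c_ij` is functional on `j`, by testing all tuples. -/
noncomputable def testFunctional (D : V → Finset U) : Cmd (Memory V U) := block [
  act fun s => { s with flag := true },
  bulk (fun s => (D s.i).card) fun s => { s with todoA := D s.i },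
  whileTake (·.todoA) (fun x s => { s with todoA := s.todoA.erase x, a := x }) [
    act fun s => { s with cnt := 0 },
    bulk (fun s => (D s.j).card) fun s => { s with todoB := D s.j },
    whileTake (·.todoB) (fun x s => { s with todoB := s.todoB.erase x, b := x }) [
      when (fun s => s.c s.i s.j s.a s.b) (act fun s => { s with cnt := s.cnt + 1 })],
    when (fun s => 2 ≤ s.cnt) (act fun s => { s with flag := false })]]

open scoped Classical in
/-- Construct the directed graph `P^F` and its reverse. -/
noncomputable def buildGraph [Fintype V] (D : V → Finset U) : Cmd (Memory V U) := block [
  bulk (fun _ => 2 * Fintype.card V) fun s => { s with F := fun _ => ∅, B := fun _ => ∅ },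
  bulk (fun _ => Fintype.card V) fun s => { s with todoV := Finset.univ },
  whileTake (·.todoV) (fun x s => { s with todoV := s.todoV.erase x, i := x }) [
    bulk (fun s => (s.N s.i).card) fun s => { s with todoN := s.N s.i },
    whileTake (·.todoN) (fun x s => { s with todoN := s.todoN.erase x, j := x }) [
      testFunctional D,
      when (fun s => s.flag = true) (act fun s =>
        { s with
          F := Function.update s.F s.i (insert s.j (s.F s.i))
          B := Function.update s.B s.j (insert s.i (s.B s.j)) })]]]

open scoped Classical in
/-- Depth-first search of the whole of `P^F`; the list `fin` receives the variables in decreasing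
order of their finishing times. `rest v` is the part of the edge list of `v` still to be explored. -/
noncomputable def depthFirstSearch [Fintype V] : Cmd (Memory V U) := block [
  bulk (fun _ => Fintype.card V) fun s => { s with visited := ∅ },
  act fun s => { s with fin := [] },
  bulk (fun _ => Fintype.card V) fun s => { s with todoV := Finset.univ },
  whileTake (·.todoV) (fun x s => { s with todoV := s.todoV.erase x, i := x }) [
    when (fun s => s.i ∉ s.visited) (block [
      act fun s => { s with visited := insert s.i s.visited, stack := [s.i] },
      bulk (fun s => (s.F s.i).card) fun s => { s with rest := Function.update s.rest s.i (s.F s.i) },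
      loop (fun s => s.stack ≠ []) (block [
        first (·.stack) (fun x s => { s with i := x }),
        cond (fun s => s.rest s.i = ∅)
          (act fun s => { s with stack := s.stack.tail, fin := s.i :: s.fin })
          (block [
            pick (fun s => s.rest s.i) (fun x s =>
              { s with rest := Function.update s.rest s.i ((s.rest s.i).erase x), j := x }),
            when (fun s => s.j ∉ s.visited) (block [
              act fun s => { s with visited := insert s.j s.visited, stack := s.j :: s.stack },
              bulk (fun s => (s.F s.j).card) fun s =>
                { s with rest := Function.update s.rest s.j (s.F s.j) }])])])])]]

open scoped Classical in
/-- The roots are taken in the order of `fin`. Every root that is still unvisited leads, through the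
reversed edges, to the variables of its strongly connected component, which are appended to `O`. The
components are thus produced one after the other in a topological order of the condensed graph. -/
noncomputable def collectComponents [Fintype V] : Cmd (Memory V U) := block [
  bulk (fun _ => Fintype.card V) fun s => { s with visited := ∅ },
  act fun s => { s with O := [] },
  loop (fun s => s.fin ≠ []) (block [
    first (·.fin) (fun x s => { s with fin := s.fin.tail, i := x }),
    when (fun s => s.i ∉ s.visited) (block [
      act fun s => { s with visited := insert s.i s.visited, stack := [s.i] },
      loop (fun s => s.stack ≠ []) (block [
        first (·.stack) (fun x s => { s with stack := s.stack.tail, i := x, O := s.O ++ [x] }),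
        bulk (fun s => (s.B s.i).card) fun s => { s with todoN := s.B s.i },
        whileTake (·.todoN) (fun x s => { s with todoN := s.todoN.erase x, j := x }) [
          when (fun s => s.j ∉ s.visited) (act fun s =>
            { s with visited := insert s.j s.visited, stack := s.j :: s.stack })]])])])]

/-- Find a functional elimination ordering `O`. -/
noncomputable def findOrdering [Fintype V] (D : V → Finset U) : Cmd (Memory V U) :=
  block [buildGraph D, depthFirstSearch, collectComponents]

open scoped Classical in
/-- Substitute `j` by `i` in `c_jk`: the constraint `c_jk` is replaced by
`c_ik ∩ (c_jk ∘ c_ij)`, where `c_ik` is universal if there is no constraint on `{i, k}`. As `c_ij` is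
functional on `j`, the row of a value `a` in the composition is the row in `c_jk` of the support of
`a` (or empty, if `a` has no support). -/
noncomputable def substitute (D : V → Finset U) : Cmd (Memory V U) := block [
  bulk (fun s => (D s.i).card) fun s => { s with todoA := D s.i },
  whileTake (·.todoA) (fun x s => { s with todoA := s.todoA.erase x, a := x }) [
    act fun s => { s with sup := none },
    bulk (fun s => (D s.j).card) fun s => { s with todoB := D s.j },
    whileTake (·.todoB) (fun x s => { s with todoB := s.todoB.erase x, b := x }) [
      when (fun s => s.c s.i s.j s.a s.b) (act fun s => { s with sup := some s.b })],
    bulk (fun s => (D s.k).card) fun s => { s with todoB := D s.k },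
    whileTake (·.todoB) (fun x s => { s with todoB := s.todoB.erase x, b := x }) [
      act fun s =>
        { s with
          c := fun v w x y =>
            if (v = s.i ∧ w = s.k ∧ x = s.a ∧ y = s.b) ∨ (v = s.k ∧ w = s.i ∧ x = s.b ∧ y = s.a) then
              (∃ z, s.sup = some z ∧ s.c s.j s.k z s.b) ∧ (s.k ∈ s.N s.i → s.c s.i s.k s.a s.b)
            else s.c v w x y }]],
  act fun s => { s with N := Function.update s.N s.j ((s.N s.j).erase s.k) },
  act fun s => { s with N := Function.update s.N s.k ((s.N s.k).erase s.j) },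
  act fun s => { s with N := Function.update s.N s.i (insert s.k (s.N s.i)) },
  act fun s => { s with N := Function.update s.N s.k (insert s.i (s.N s.k)) }]

open scoped Classical in
/-- The loop over the ordering `O`. Every variable `i` that is not yet eliminated is substituted for
all variables that are reachable from it through qualified constraints, i.e. constraints that were
functional in the input and still exist. -/
noncomputable def eliminate [Fintype V] (D : V → Finset U) : Cmd (Memory V U) := block [
  bulk (fun _ => Fintype.card V) fun s => { s with eliminated := ∅ },
  loop (fun s => s.O ≠ []) (block [
    first (·.O) (fun x s => { s with O := s.O.tail, i := x }),
    when (fun s => s.i ∉ s.eliminated) (block [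
      act fun s => { s with L := ∅ },
      bulk (fun s => (s.N s.i).card) fun s => { s with todoN := s.N s.i },
      whileTake (·.todoN) (fun x s => { s with todoN := s.todoN.erase x, j := x }) [
        when (fun s => s.j ∈ s.F s.i) (act fun s => { s with L := insert s.j s.L })],
      whileTake (·.L) (fun x s => { s with L := s.L.erase x, j := x }) [
        loop (fun s => ∃ k ∈ s.N s.j, k ≠ s.i) (block [
          pick (fun s => (s.N s.j).erase s.i) (fun x s => { s with k := x }),
          substitute D,
          when (fun s => s.k ∈ s.F s.j) (act fun s => { s with L := insert s.k s.L })]),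
        act fun s => { s with eliminated := insert s.j s.eliminated }]])])]

end LinearElimination

/-- The whole algorithm: find a functional elimination ordering, then eliminate along it. -/
noncomputable def linearElimination {V U : Type} [Fintype V] (D : V → Finset U) :
    Cmd (Memory V U) :=
  Cmd.seq (LinearElimination.findOrdering D) (LinearElimination.eliminate D)

/-! Both parts of the algorithm are analysed by invariants and potentials. In step 1, testing a
constraint in both directions costs $O(d^2)$, hence $O(ed^2)$ in all, since the degrees sum to $2e$;
the two graph searches cost only $O(n+e)$. Their correctness rests on one property of the finishing
order `fin`: every suffix of it that contains the strongly connected component of a vertex contains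
everything reachable from that vertex (`DFSState.suffix_closed`, proved in `DFSState.finish`).
Consequently an unlisted vertex that reaches the next root is reached by it
(`OrderedComponents.reach_of_reach`), so each reverse search collects exactly one component.

In step 2, a substitution costs $O(d^2)$ and replaces an edge $\{j,k\}$ by $\{i,k\}$. The degree of
$j$ drops, that of $k$ does not grow, and only the root $i$ can gain a neighbour. The potential is
the sum of $60+120d^2\deg v$ over the variables still ahead in $O$ and not eliminated. The root is
no longer counted, so every substitution lowers the potential by at least $120d^2$
(`elimPotential_redirect`), and the number of substitutions is at most the initial degree sum $2e$.

This needs the substituted variable $j$ to be still counted, and here the ordering enters. The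
variables already considered or eliminated form a set closed under functional edges. If a variable
reachable from the root $i$ had been considered before $i$, the ordering would give a path back to
$i$, so $i$ would have been eliminated (`BetweenPhases.mem_of_reach`). The contents of the
constraints play no role in step 2: functionality is recorded from the input, and a substitution
costs $O(d^2)$ whatever the tuples are. -/

namespace Cmd

/-! ### A program logic with costs for nondeterministic commands. -/

variable {σ α : Type}

/-- Every execution from the configuration `x`, which has been reached at the cost `m`, ends, and
`Q` holds of the final memory and the total cost. -/
inductive Terminates (Q : σ → ℕ → Prop) : List (Cmd σ) × σ → ℕ → Prop
  | done {s m} : Q s m → Terminates Q ([], s) m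
  | step {x m} : (∃ u y, Step x u y) → (∀ u y, Step x u y → Terminates Q y (m + u)) →
      Terminates Q x m

/-- Costs only accumulate and some continuation always exists, so the bound at the end of any one
continuation bounds the cost spent so far. -/
theorem Terminates.le {Q : σ → Prop} {t m : ℕ} {x : List (Cmd σ) × σ}
    (h : Terminates (fun s m => m ≤ t ∧ Q s) x m) : m ≤ t := by
  induction h with
  | done h => exact h.1
  | step hex _ ih =>
    obtain ⟨u, y, hy⟩ := hex
    have := ih u y hy
    omega

theorem Terminates.exec {Q : σ → ℕ → Prop} {t : ℕ} {x y : List (Cmd σ) × σ}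
    (h : Exec x t y) (hx : Terminates Q x 0) : Terminates Q y t := by
  induction h with
  | refl => exact hx
  | tail _ hs ih =>
    cases ih with
    | done h => cases hs
    | step _ h => exact h _ _ hs

/-- Every execution of `p` from `s` ends, and `Q` holds of the final memory and the cost. -/
def Runs (p : Cmd σ) (s : σ) (Q : σ → ℕ → Prop) : Prop :=
  -- Quantifying over the remaining commands, the cost already spent and the final postcondition
  -- makes sequential composition a mere nesting of continuations; executions never have to be
  -- split.
  ∀ (r : List (Cmd σ)) (m : ℕ) (Q' : σ → ℕ → Prop),
    (∀ s' m', Q s' m' → Terminates Q' (r, s') (m + m')) → Terminates Q' (p :: r, s) m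

theorem Runs.runsWithin {p : Cmd σ} {s : σ} {t : ℕ} {Q : σ → Prop}
    (h : Runs p s fun s' m => m ≤ t ∧ Q s') : RunsWithin p s t Q := by
  intro r s' m hex
  have hT : Terminates (fun s' m => m ≤ t ∧ Q s') ([p], s) 0 :=
    h [] 0 _ fun s' m' hm => .done (by simpa using hm)
  have h' := hT.exec hex
  refine ⟨h'.le, ?_, ?_⟩
  · rintro rfl
    cases h' with
    | done h => exact h.2
    | step h _ => obtain ⟨_, _, h⟩ := h; cases h
  · intro hr
    cases h' with
    | done h => exact absurd rfl hr
    | step h _ => exact h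

theorem Runs.mono {p : Cmd σ} {s : σ} {Q Q' : σ → ℕ → Prop} (h : Runs p s Q)
    (hQ : ∀ s' m, Q s' m → Q' s' m) : Runs p s Q' :=
  fun r m Q'' hr => h r m Q'' fun s' m' hm => hr s' m' (hQ _ _ hm)

theorem Runs.skip {s : σ} {Q : σ → ℕ → Prop} (h : Q s 1) : Runs skip s Q := by
  intro r m Q' hr
  refine .step ⟨_, _, .skip⟩ fun u y hy => ?_
  cases hy
  exact hr _ _ h

theorem Runs.prim {w : σ → ℕ} {R : σ → σ → Prop} {s : σ} {Q : σ → ℕ → Prop}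
    (hex : ∃ s', R s s') (h : ∀ s', R s s' → Q s' (1 + w s)) : Runs (prim w R) s Q := by
  intro r m Q' hr
  obtain ⟨s', hs'⟩ := hex
  refine .step ⟨_, _, .prim hs'⟩ fun u y hy => ?_
  cases hy with
  | prim hR => exact hr _ _ (h _ hR)

theorem Runs.act {f : σ → σ} {s : σ} {Q : σ → ℕ → Prop} (h : Q (f s) 1) : Runs (act f) s Q :=
  .prim ⟨_, rfl⟩ (by rintro _ rfl; exact h)

theorem Runs.bulk {w : σ → ℕ} {f : σ → σ} {s : σ} {Q : σ → ℕ → Prop} (h : Q (f s) (1 + w s)) :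
    Runs (bulk w f) s Q :=
  .prim ⟨_, rfl⟩ (by rintro _ rfl; exact h)

theorem Runs.pick {S : σ → Finset α} {put : α → σ → σ} {s : σ} {Q : σ → ℕ → Prop}
    (hne : (S s).Nonempty) (h : ∀ x ∈ S s, Q (put x s) 1) : Runs (pick S put) s Q :=
  .prim (by obtain ⟨x, hx⟩ := hne; exact ⟨_, x, hx, rfl⟩)
    (by rintro _ ⟨x, hx, rfl⟩; exact h x hx)

theorem Runs.first {S : σ → List α} {put : α → σ → σ} {s : σ} {Q : σ → ℕ → Prop} {x : α}
    {l : List α} (hS : S s = x :: l) (h : Q (put x s) 1) : Runs (first S put) s Q :=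
  .prim ⟨_, x, by simp [hS], rfl⟩ (by
    rintro _ ⟨y, hy, rfl⟩
    rw [hS, List.head?_cons, Option.some.injEq] at hy
    exact hy ▸ h)

theorem Runs.seq {p q : Cmd σ} {s : σ} {Q : σ → ℕ → Prop}
    (h : Runs p s fun s' m => Runs q s' fun s'' m' => Q s'' (1 + m + m')) :
    Runs (seq p q) s Q := by
  intro r m Q' hr
  refine .step ⟨_, _, .seq⟩ fun u y hy => ?_
  cases hy
  refine h _ _ _ fun s' m' h' => h' _ _ _ fun s'' m'' h'' => ?_
  have := hr _ _ h''
  rwa [show m + 1 + m' + m'' = m + (1 + m' + m'') by omega]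

theorem Runs.cond {b : σ → Prop} {p q : Cmd σ} {s : σ} {Q : σ → ℕ → Prop}
    (hp : b s → Runs p s fun s' m => Q s' (1 + m))
    (hq : ¬ b s → Runs q s fun s' m => Q s' (1 + m)) : Runs (cond b p q) s Q := by
  intro r m Q' hr
  by_cases hb : b s
  · refine .step ⟨_, _, .cond_true hb⟩ fun u y hy => ?_
    cases hy with
    | cond_true _ =>
      refine hp hb _ _ _ fun s' m' h' => ?_
      rw [show m + 1 + m' = m + (1 + m') by omega]
      exact hr _ _ h'
    | cond_false h => exact absurd hb h
  · refine .step ⟨_, _, .cond_false hb⟩ fun u y hy => ?_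
    cases hy with
    | cond_true h => exact absurd h hb
    | cond_false _ =>
      refine hq hb _ _ _ fun s' m' h' => ?_
      rw [show m + 1 + m' = m + (1 + m') by omega]
      exact hr _ _ h'

theorem Runs.when {b : σ → Prop} {p : Cmd σ} {s : σ} {Q : σ → ℕ → Prop}
    (hp : b s → Runs p s fun s' m => Q s' (1 + m)) (hq : ¬ b s → Q s 2) :
    Runs (when b p) s Q :=
  .cond hp fun h => .skip (hq h)

theorem Runs.block_nil {s : σ} {Q : σ → ℕ → Prop} (h : Q s 1) : Runs (block []) s Q := .skip h

theorem Runs.block_cons {p : Cmd σ} {l : List (Cmd σ)} {s : σ} {Q : σ → ℕ → Prop}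
    (h : Runs p s fun s' m => Runs (block l) s' fun s'' m' => Q s'' (1 + m + m')) :
    Runs (block (p :: l)) s Q := .seq h

/-- A loop whose body preserves `Inv` and is paid for by the decrease of the potential `Φ`. -/
theorem Runs.loop {b : σ → Prop} {p : Cmd σ} {s : σ} {Q : σ → ℕ → Prop} (Inv : σ → Prop)
    (Φ : σ → ℕ) (h0 : Inv s)
    (hstep : ∀ s, Inv s → b s → Runs p s fun s' m => Inv s' ∧ 1 + m + Φ s' ≤ Φ s)
    (hQ : ∀ s' m, Inv s' → ¬ b s' → m + Φ s' ≤ Φ s + 1 → Q s' m) : Runs (loop b p) s Q := by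
  -- `Q` is generalised because the remaining iterations are run against a postcondition shifted by
  -- the cost of the iteration just done.
  induction hn : Φ s using Nat.strong_induction_on generalizing s Q with
  | _ n ih =>
    intro r m Q' hr
    by_cases hb : b s
    · refine .step ⟨_, _, .loop_true hb⟩ fun u y hy => ?_
      cases hy with
      | loop_true _ =>
        refine hstep s h0 hb _ _ _ fun s' m' h' => ?_
        obtain ⟨hI, hle⟩ := h'
        refine ih (Φ s') (by omega) hI (Q := fun s'' m'' => Q s'' (1 + m' + m'')) ?_ rfl _ _ _ ?_
        · intro s'' m'' hI' hb' hle'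
          exact hQ _ _ hI' hb' (by omega)
        · intro s'' m'' h''
          rw [show m + 1 + m' + m'' = m + (1 + m' + m'') by omega]
          exact hr _ _ h''
      | loop_false h => exact absurd hb h
    · refine .step ⟨_, _, .loop_false hb⟩ fun u y hy => ?_
      cases hy with
      | loop_true h => exact absurd h hb
      | loop_false _ => exact hr _ _ (hQ _ _ h0 hb (by omega))

/-- The overhead 3 of an iteration is the loop test, the sequencing step and the choice of the
element. -/
theorem Runs.whileTake {S : σ → Finset α} {put : α → σ → σ} {l : List (Cmd σ)} {s : σ}
    {Q : σ → ℕ → Prop} (Inv : σ → Prop) (Φ : σ → ℕ) (h0 : Inv s)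
    (hstep : ∀ s, Inv s → ∀ x ∈ S s,
      Runs (block l) (put x s) fun s' m => Inv s' ∧ 3 + m + Φ s' ≤ Φ s)
    (hQ : ∀ s' m, Inv s' → S s' = ∅ → m + Φ s' ≤ Φ s + 1 → Q s' m) :
    Runs (whileTake S put l) s Q := by
  refine .loop Inv Φ h0 (fun s hs hne => ?_) fun s' m hI hb hle =>
    hQ s' m hI (Finset.not_nonempty_iff_eq_empty.1 hb) hle
  refine .block_cons (.pick hne fun x hx => (hstep s hs x hx).mono ?_)
  rintro s' m ⟨h1, h2⟩
  exact ⟨h1, by omega⟩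

end Cmd

/-! ### Testing functionality and building the functional graph. -/

namespace LinearElimination

open Cmd

variable {V U : Type}

open scoped Classical in
/-- The innermost loop of `testFunctional` counts the supports of `a`. -/
theorem runs_countSupports (D : V → Finset U) (s : Memory V U) (hT : s.todoB = D s.j)
    (hc : s.cnt = 0) :
    Runs (whileTake (·.todoB) (fun x s => { s with todoB := s.todoB.erase x, b := x }) [
      when (fun s => s.c s.i s.j s.a s.b) (act fun s => { s with cnt := s.cnt + 1 })]) s
      fun s' m => m ≤ 8 * (D s.j).card + 1 ∧ ∃ b, s' =
        { s with
          b := b, todoB := ∅, cnt := ((D s.j).filter fun b => s.c s.i s.j s.a b).card } := by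
  refine Runs.whileTake
    (fun s' => ∃ T ⊆ D s.j, ∃ b, s' =
      { s with
        b := b, todoB := T, cnt := ((D s.j \ T).filter fun b => s.c s.i s.j s.a b).card })
    (fun s' => 8 * s'.todoB.card) ⟨D s.j, subset_rfl, s.b, ?_⟩ ?_ ?_
  · simp [← hT, ← hc]
  · rintro _ ⟨T, hT, b, rfl⟩ x hx
    have hx : x ∈ T := hx
    have hcard := Finset.card_erase_add_one hx
    have hins : D s.j \ T.erase x = insert x (D s.j \ T) := by
      rw [Finset.sdiff_erase (hT hx)]
    have hsub := (Finset.erase_subset x T).trans hT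
    refine Runs.block_cons (.when (fun h => .act ?_) fun h => ?_) <;>
      refine .block_nil ⟨⟨T.erase x, hsub, x, ?_⟩, ?_⟩
    · simp only [hins, Memory.mk.injEq, true_and, and_true]
      rw [Finset.filter_insert, if_pos h, Finset.card_insert_of_notMem (by simp [hx])]
    · dsimp only
      omega
    · simp only [hins, Memory.mk.injEq, true_and, and_true]
      rw [Finset.filter_insert, if_neg h]
    · dsimp only
      omega
  · rintro _ m ⟨T, hT', b, rfl⟩ hS hm
    have hS : T = ∅ := hS
    subst hS
    refine ⟨?_, b, by simp⟩
    simp only [Finset.card_empty, hT] at hm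
    omega

open scoped Classical in
theorem runs_testFunctional (D : V → Finset U) {d : ℕ} (hd : ∀ i, (D i).card ≤ d) (h0 : 0 < d)
    (s : Memory V U) :
    Runs (testFunctional D) s fun s' m => m ≤ 50 * d ^ 2 ∧
      (∃ f a b n A B, s' =
        { s with flag := f, a := a, b := b, cnt := n, todoA := A, todoB := B }) ∧
      (s'.flag = true ↔ ∀ a ∈ D s.i, ∀ b ∈ D s.j, ∀ b' ∈ D s.j,
        s.c s.i s.j a b → s.c s.i s.j a b' → b = b') := by
  have hone : ∀ a, ((D s.j).filter fun b => s.c s.i s.j a b).card ≤ 1 ↔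
      ∀ b ∈ D s.j, ∀ b' ∈ D s.j, s.c s.i s.j a b → s.c s.i s.j a b' → b = b' := by
    intro a
    rw [Finset.card_le_one]
    simp only [Finset.mem_filter]
    exact ⟨fun h b hb b' hb' h1 h2 => h b ⟨hb, h1⟩ b' ⟨hb', h2⟩,
      fun h b hb b' hb' => h b hb.1 b' hb'.1 hb.2 hb'.2⟩
  refine .block_cons (.act (.block_cons (.bulk (.block_cons (.whileTake
    (fun s' => ∃ f a b n A B, s' =
        { s with flag := f, a := a, b := b, cnt := n, todoA := A, todoB := B } ∧ A ⊆ D s.i ∧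
        (f = true ↔ ∀ a ∈ D s.i \ A, ((D s.j).filter fun b => s.c s.i s.j a b).card ≤ 1))
    -- Each value of `i` pays for copying the domain of `j` (at most `d`), for the counting loop (at
    -- most `8 * d + 1`) and for bookkeeping. As `0 < d`, additive constants are absorbed into `d ^
    -- 2` at the end.
    (fun s' => (9 * d + 20) * s'.todoA.card)
    ⟨true, s.a, s.b, s.cnt, D s.i, s.todoB, rfl, subset_rfl, by simp⟩ ?_ ?_)))))
  · rintro _ ⟨f, a, b, n, A, B, rfl, hA, hf⟩ x hx
    have hx : x ∈ A := hx
    have hcard := Finset.card_erase_add_one hx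
    have hins : D s.i \ A.erase x = insert x (D s.i \ A) := Finset.sdiff_erase (hA hx)
    have hsub := (Finset.erase_subset x A).trans hA
    have hj := hd s.j
    refine .block_cons (.act (.block_cons (.bulk (.block_cons
      ((runs_countSupports D _ rfl rfl).mono ?_)))))
    rintro _ m ⟨hm, b', rfl⟩
    dsimp only at hm ⊢
    refine .block_cons (.when (fun h => .act (.block_nil ?_)) fun h => .block_nil ?_)
    · refine ⟨⟨_, _, _, _, _, _, rfl, hsub, ?_⟩, ?_⟩
      · rw [hins]
        simp only [Bool.false_eq_true, false_iff]
        intro hall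
        have := hall x (Finset.mem_insert_self _ _)
        dsimp only at h
        omega
      · dsimp only
        rw [← hcard, mul_add]
        omega
    · refine ⟨⟨_, _, _, _, _, _, rfl, hsub, ?_⟩, ?_⟩
      · rw [hins, hf, Finset.forall_mem_insert]
        exact ⟨fun h' => ⟨by dsimp only at h; omega, h'⟩, fun h' => h'.2⟩
      · dsimp only
        rw [← hcard, mul_add]
        omega
  · rintro _ m ⟨f, a, b, n, A, B, rfl, hA, hf⟩ hS hm
    have hS : A = ∅ := hS
    subst hS
    refine .block_nil ⟨?_, ⟨_, _, _, _, _, _, rfl⟩, ?_⟩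
    · have hi := hd s.i
      dsimp only at hm ⊢
      simp only [Finset.card_empty] at hm
      nlinarith [Nat.mul_le_mul_left (9 * d + 20) hi]
    · simp only [hf, Finset.sdiff_empty, hone]

/-- In the relation `c`, every value of `i` is compatible with at most one value of `j`. -/
def FunctionalOn (D : V → Finset U) (c : V → V → U → U → Prop) (i j : V) : Prop :=
  ∀ a ∈ D i, ∀ b ∈ D j, ∀ b' ∈ D j, c i j a b → c i j a b' → b = b'

open scoped Classical in
theorem runs_buildRow (D : V → Finset U) {d : ℕ} (hd : ∀ i, (D i).card ≤ d) (h0 : 0 < d)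
    (s : Memory V U) (hT : s.todoN = s.N s.i) (hB : ∀ v w, v ∈ s.B w ↔ w ∈ s.F v) :
    Runs (whileTake (·.todoN) (fun x s => { s with todoN := s.todoN.erase x, j := x }) [
      testFunctional D,
      when (fun s => s.flag = true) (act fun s =>
        { s with
          F := Function.update s.F s.i (insert s.j (s.F s.i))
          B := Function.update s.B s.j (insert s.i (s.B s.j)) })]) s
      fun s' m => m ≤ 60 * d ^ 2 * (s.N s.i).card + 1 ∧
        s'.N = s.N ∧ s'.c = s.c ∧ s'.todoV = s.todoV ∧
        (∀ v w, w ∈ s'.F v ↔ w ∈ s.F v ∨ v = s.i ∧ w ∈ s.N s.i ∧ FunctionalOn D s.c s.i w) ∧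
        ∀ v w, v ∈ s'.B w ↔ w ∈ s'.F v := by
  have hd2 : 0 < d ^ 2 := by positivity
  refine Runs.whileTake
    (fun s' => s'.N = s.N ∧ s'.c = s.c ∧ s'.todoV = s.todoV ∧ s'.i = s.i ∧ s'.todoN ⊆ s.N s.i ∧
      (∀ v w, w ∈ s'.F v ↔
        w ∈ s.F v ∨ v = s.i ∧ w ∈ s.N s.i \ s'.todoN ∧ FunctionalOn D s.c s.i w) ∧
      ∀ v w, v ∈ s'.B w ↔ w ∈ s'.F v)
    (fun s' => 60 * d ^ 2 * s'.todoN.card) ⟨rfl, rfl, rfl, rfl, hT.subset, by simp [hT], hB⟩ ?_ ?_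
  · rintro s₁ ⟨hN, hc, hV, hi, hs, hF, hB⟩ x hx
    have hcard := Finset.card_erase_add_one hx
    have hins : s.N s.i \ s₁.todoN.erase x = insert x (s.N s.i \ s₁.todoN) :=
      Finset.sdiff_erase (hs hx)
    have hsub := (Finset.erase_subset x s₁.todoN).trans hs
    refine .block_cons ((runs_testFunctional D hd h0 _).mono ?_)
    rintro _ m ⟨hm, ⟨f, a, b, n, A, B, rfl⟩, hf⟩
    dsimp only at hf ⊢
    rw [hi, hc] at hf
    refine .block_cons (.when (fun h => .act (.block_nil ?_)) fun h => .block_nil ?_)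
    · refine ⟨⟨hN, hc, hV, hi, hsub, ?_, ?_⟩, ?_⟩
      · intro v w
        dsimp only at h ⊢
        have hfun : FunctionalOn D s.c s.i x := hf.1 h
        rw [hins, Function.update_apply]
        split_ifs with hv
        · subst hv
          rw [Finset.mem_insert, Finset.mem_insert, hF, hi]
          constructor
          · rintro (rfl | h | ⟨h1, h2, h3⟩)
            · exact .inr ⟨rfl, .inl rfl, hfun⟩
            · exact .inl h
            · exact .inr ⟨rfl, .inr h2, h3⟩
          · rintro (h | ⟨h1, rfl | h2, h3⟩)
            · exact .inr (.inl h)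
            · exact .inl rfl
            · exact .inr (.inr ⟨rfl, h2, h3⟩)
        · rw [hi] at hv
          simp [hF, hv]
      · intro v w
        dsimp only
        rw [Function.update_apply, Function.update_apply]
        split_ifs with h1 h2 h2
        · simp [h1, h2]
        · subst h1
          simp [hB, h2]
        · subst h2
          simp [hB, h1]
        · exact hB v w
      · dsimp only
        rw [← hcard, mul_add]
        omega
    · refine ⟨⟨hN, hc, hV, hi, hsub, ?_, hB⟩, ?_⟩
      · intro v w
        dsimp only at h ⊢
        have hfun : ¬ FunctionalOn D s.c s.i x := fun h' => h (hf.2 h')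
        rw [hins, hF, Finset.mem_insert]
        constructor
        · rintro (h | ⟨h1, h2, h3⟩)
          · exact .inl h
          · exact .inr ⟨h1, .inr h2, h3⟩
        · rintro (h | ⟨h1, rfl | h2, h3⟩)
          · exact .inl h
          · exact absurd h3 hfun
          · exact .inr ⟨h1, h2, h3⟩
      · dsimp only
        rw [← hcard, mul_add]
        omega
  · rintro s' m ⟨hN, hc, hV, hi, hs, hF, hB⟩ hS hm
    refine ⟨?_, hN, hc, hV, ?_, hB⟩
    · rw [hT] at hm
      omega
    · simpa [hS] using hF

open scoped Classical in
theorem runs_buildGraph [Fintype V] (D : V → Finset U) {d : ℕ} (hd : ∀ i, (D i).card ≤ d)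
    (h0 : 0 < d) (s : Memory V U) :
    Runs (buildGraph D) s fun s' m =>
      m ≤ 60 * d ^ 2 * (∑ v, (s.N v).card) + ∑ v, (s.N v).card + 20 * Fintype.card V + 20 ∧
        s'.N = s.N ∧ s'.c = s.c ∧
        (∀ v w, w ∈ s'.F v ↔ w ∈ s.N v ∧ FunctionalOn D s.c v w) ∧
        ∀ v w, v ∈ s'.B w ↔ w ∈ s'.F v := by
  refine .block_cons (.bulk (.block_cons (.bulk (.block_cons (.whileTake
    (fun s' => s'.N = s.N ∧ s'.c = s.c ∧
      (∀ v w, w ∈ s'.F v ↔ v ∉ s'.todoV ∧ w ∈ s.N v ∧ FunctionalOn D s.c v w) ∧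
      ∀ v w, v ∈ s'.B w ↔ w ∈ s'.F v)
    -- A variable pays for the tests of its neighbours, the copy of its neighbour list and the loop
    -- overhead.
    (fun s' => ∑ v ∈ s'.todoV, (60 * d ^ 2 * (s.N v).card + (s.N v).card + 15))
    ⟨rfl, rfl, by simp, by simp⟩ ?_ ?_)))))
  · rintro s₁ ⟨hN, hc, hF, hB⟩ x hx
    have hsum := Finset.sum_erase_add s₁.todoV
      (fun v => 60 * d ^ 2 * (s.N v).card + (s.N v).card + 15) hx
    refine .block_cons (.bulk (.block_cons ((runs_buildRow D hd h0 _ rfl (by exact hB)).mono ?_)))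
    rintro s₂ m ⟨hm, hN', hc', hV', hF', hB'⟩
    dsimp only at hm hN' hc' hV' hF' ⊢
    refine .block_nil ⟨⟨hN'.trans hN, hc'.trans hc, ?_, hB'⟩, ?_⟩
    · intro v w
      rw [hF', hF, hV', hN, hc]
      by_cases hv : v = x
      · subst hv
        simp [hx]
      · simp [hv]
    · rw [hV', ← hsum]
      rw [hN] at hm ⊢
      omega
  · rintro s' m ⟨hN, hc, hF, hB⟩ hS hm
    refine .block_nil ⟨?_, hN, hc, by simpa [hS] using hF, hB⟩
    rw [hS] at hm
    dsimp only at hm ⊢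
    simp only [Finset.sum_empty, Finset.sum_add_distrib, ← Finset.mul_sum, Finset.sum_const,
      Finset.card_univ, smul_eq_mul] at hm
    omega

/-! ### Depth-first search and the property of its finishing order. -/

/-- Reachability in the directed graph with the adjacency lists `F`. -/
abbrev Reach (F : V → Finset V) : V → V → Prop := Relation.ReflTransGen fun v w => w ∈ F v

/-- If `l` contains the strongly connected component of a vertex, then it contains everything that
can be reached from this vertex. -/
def ComponentClosed (F : V → Finset V) (l : List V) : Prop :=
  ∀ u, (∀ w, Reach F u w → Reach F w u → w ∈ l) → ∀ x, Reach F u x → x ∈ l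

/-- A state of a depth-first search: `stack` is the current path, `fin` the list of the finished
vertices, the last one in front. -/
structure DFSState (F : V → Finset V) (stack fin : List V) (visited : Finset V)
    (rest : V → Finset V) : Prop where
  nodup : (stack ++ fin).Nodup
  mem_visited : ∀ v, v ∈ visited ↔ v ∈ stack ∨ v ∈ fin
  reach_stack : stack.Pairwise fun a b => Reach F b a
  fin_closed : ∀ x ∈ fin, ∀ y ∈ F x, y ∈ visited
  stack_closed : ∀ x ∈ stack, ∀ y ∈ F x, y ∈ visited ∨ y ∈ rest x
  rest_subset : ∀ x ∈ stack, rest x ⊆ F x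
  -- This is what carries `suffix_closed` through the search: a finished vertex from which something
  -- unfinished can be reached shares its component with a vertex of the current path.
  fin_reach : ∀ x ∈ fin, (∀ y, Reach F x y → y ∈ fin) ∨ ∃ z ∈ stack, Reach F x z ∧ Reach F z x
  -- Suffixes matter because the second search consumes `fin` from the front. They also replace
  -- finishing times: a suffix is a past value of `fin`.
  suffix_closed : ∀ l, l <:+ fin → ComponentClosed F l

namespace DFSState

variable {F : V → Finset V} {stack fin : List V} {visited : Finset V} {rest : V → Finset V}

theorem init (F : V → Finset V) (rest : V → Finset V) : DFSState F [] [] ∅ rest := by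
  constructor <;> try simp
  intro u h x _
  simpa using h u .refl .refl

open scoped Classical in
theorem push (h : DFSState F stack fin visited rest) {v : V} (hv : v ∉ visited)
    (hr : ∀ x ∈ stack, Reach F x v) :
    DFSState F (v :: stack) fin (insert v visited) (Function.update rest v (F v)) where
  nodup := by
    rw [List.cons_append, List.nodup_cons, List.mem_append, ← h.mem_visited]
    exact ⟨hv, h.nodup⟩
  mem_visited w := by
    rw [Finset.mem_insert, h.mem_visited, List.mem_cons, or_assoc]
  reach_stack := List.pairwise_cons.2 ⟨hr, h.reach_stack⟩
  fin_closed x hx y hy := Finset.mem_insert_of_mem (h.fin_closed x hx y hy)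
  stack_closed x hx y hy := by
    by_cases hxv : x = v
    · subst hxv
      exact .inr (by simpa using hy)
    · rw [Function.update_of_ne hxv]
      exact (h.stack_closed x ((List.mem_cons.1 hx).resolve_left hxv) y hy).imp_left
        Finset.mem_insert_of_mem
  rest_subset x hx := by
    by_cases hxv : x = v
    · subst hxv
      simp
    · rw [Function.update_of_ne hxv]
      exact h.rest_subset x ((List.mem_cons.1 hx).resolve_left hxv)
  fin_reach x hx := (h.fin_reach x hx).imp_right fun ⟨z, hz, h'⟩ =>
    ⟨z, List.mem_cons_of_mem _ hz, h'⟩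
  suffix_closed := h.suffix_closed

open scoped Classical in
theorem skip {i j : V} (h : DFSState F (i :: stack) fin visited rest) (hj : j ∈ visited) :
    DFSState F (i :: stack) fin visited (Function.update rest i ((rest i).erase j)) where
  nodup := h.nodup
  mem_visited := h.mem_visited
  reach_stack := h.reach_stack
  fin_closed := h.fin_closed
  stack_closed x hx y hy := by
    by_cases hxi : x = i
    · subst hxi
      by_cases hyj : y = j
      · exact .inl (hyj ▸ hj)
      · rw [Function.update_self, Finset.mem_erase]
        exact (h.stack_closed x hx y hy).imp_right fun h' => ⟨hyj, h'⟩
    · rw [Function.update_of_ne hxi]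
      exact h.stack_closed x hx y hy
  rest_subset x hx := by
    by_cases hxi : x = i
    · subst hxi
      rw [Function.update_self]
      exact (Finset.erase_subset _ _).trans (h.rest_subset x hx)
    · rw [Function.update_of_ne hxi]
      exact h.rest_subset x hx
  fin_reach := h.fin_reach
  suffix_closed := h.suffix_closed

open scoped Classical in
-- This differs from `push` only in the edge list of `i`, where the deleted target `j` has just
-- become visited.
theorem pushChild {i j : V} (h : DFSState F (i :: stack) fin visited rest) (hj : j ∉ visited)
    (hij : j ∈ rest i) :
    DFSState F (j :: i :: stack) fin (insert j visited)
      (Function.update (Function.update rest i ((rest i).erase j)) j (F j)) := by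
  have hne : i ≠ j := by
    rintro rfl
    exact hj ((h.mem_visited i).2 (.inl List.mem_cons_self))
  have hreach : Reach F i j := .single (h.rest_subset i List.mem_cons_self hij)
  have hpush := h.push hj fun x hx => by
    rcases List.mem_cons.1 hx with rfl | hx
    · exact hreach
    · exact ((List.pairwise_cons.1 h.reach_stack).1 x hx).trans hreach
  have hval : ∀ x, x ≠ i → Function.update (Function.update rest i ((rest i).erase j)) j (F j) x =
      Function.update rest j (F j) x := by
    intro x hx
    by_cases hxj : x = j
    · subst hxj
      simp
    · simp [hxj, hx]
  exact { hpush with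
    stack_closed := fun x hx y hy => by
      by_cases hxi : x = i
      · subst hxi
        rw [Function.update_of_ne hne, Function.update_self]
        by_cases hyj : y = j
        · exact .inl (hyj ▸ Finset.mem_insert_self _ _)
        · have := hpush.stack_closed x hx y hy
          rw [Function.update_of_ne hne] at this
          exact this.imp_right fun h' => Finset.mem_erase.2 ⟨hyj, h'⟩
      · rw [hval x hxi]
        exact hpush.stack_closed x hx y hy
    rest_subset := fun x hx => by
      by_cases hxi : x = i
      · subst hxi
        rw [Function.update_of_ne hne, Function.update_self]
        exact (Finset.erase_subset _ _).trans (h.rest_subset x List.mem_cons_self)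
      · rw [hval x hxi]
        exact hpush.rest_subset x hx }

theorem finish {i : V} (h : DFSState F (i :: stack) fin visited rest) (hi : rest i = ∅) :
    DFSState F stack (i :: fin) visited rest := by
  have hnodup : (stack ++ i :: fin).Nodup := List.nodup_middle.2 h.nodup
  have hvis : ∀ v, v ∈ visited ↔ v ∈ stack ∨ v ∈ i :: fin := fun v => by
    rw [h.mem_visited, List.mem_cons, List.mem_cons]
    tauto
  have hclosed : ∀ x ∈ i :: fin, ∀ y ∈ F x, y ∈ visited := fun x hx y hy => by
    rcases List.mem_cons.1 hx with rfl | hx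
    · exact (h.stack_closed x List.mem_cons_self y hy).resolve_right (by simp [hi])
    · exact h.fin_closed x hx y hy
  have hback := (List.pairwise_cons.1 h.reach_stack).1
  -- Edges leaving `i :: fin` end in visited vertices. A path from `i` therefore stays in `i :: fin`
  -- or meets the stack, and every stack vertex reaches `i`, which puts it into the component of
  -- `i`.
  have hexit : (∀ y, Reach F i y → y ∈ i :: fin) ∨ ∃ z ∈ stack, Reach F i z ∧ Reach F z i := by
    by_contra! hcon
    obtain ⟨⟨y, hy, hyn⟩, hno⟩ := hcon
    refine hyn ?_
    clear hyn
    induction hy with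
    | refl => exact List.mem_cons_self
    | tail hp hq ih =>
      rcases (hvis _).1 (hclosed _ ih _ hq) with hs | hf
      · exact absurd (hback _ hs) (hno _ hs (hp.tail hq))
      · exact hf
  have hreach : ∀ x ∈ i :: fin,
      (∀ y, Reach F x y → y ∈ i :: fin) ∨ ∃ z ∈ stack, Reach F x z ∧ Reach F z x := by
    intro x hx
    rcases List.mem_cons.1 hx with rfl | hx
    · exact hexit
    · rcases h.fin_reach x hx with hf | ⟨z, hz, h1, h2⟩
      · exact .inl fun y hy => List.mem_cons_of_mem _ (hf y hy)
      · rcases List.mem_cons.1 hz with rfl | hz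
        -- The witness for `x` was `i` itself, which leaves the stack, so `x` inherits the
        -- alternative that holds for `i`.
        · exact hexit.imp (fun hf y hy => hf y (h2.trans hy)) fun ⟨w, hw, h3, h4⟩ =>
            ⟨w, hw, h1.trans h3, h4.trans h2⟩
        · exact .inr ⟨z, hz, h1, h2⟩
  refine ⟨hnodup, hvis, (List.pairwise_cons.1 h.reach_stack).2, hclosed,
    fun x hx => h.stack_closed x (List.mem_cons_of_mem _ hx),
    fun x hx => h.rest_subset x (List.mem_cons_of_mem _ hx), hreach, fun l hl => ?_⟩
  rcases List.suffix_cons_iff.1 hl with rfl | hl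
  · intro u hu
    rcases hreach u (hu u .refl .refl) with hf | ⟨z, hz, h1, h2⟩
    · exact hf
    -- A stack vertex in the component of `u` is not finished, so the component is not contained in
    -- the list.
    · exact absurd (hu z h1 h2) fun hz' => (List.disjoint_of_nodup_append hnodup) hz hz'
  · exact h.suffix_closed l hl

end DFSState

/-- The potential of the depth-first search. -/
noncomputable def dfsPotential [Fintype V] (F : V → Finset V) (stack : List V)
    (visited : Finset V) (rest : V → Finset V) : ℕ :=
  open scoped Classical in
  -- An unvisited vertex pays for being pushed, including the copy of its edge list. What it keeps
  -- on the stack pays 20 for each edge to be explored and 20 for the final pop.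
  ∑ v ∈ visitedᶜ, (60 + 22 * (F v).card) + (stack.map fun v => 20 + 20 * (rest v).card).sum

open scoped Classical in
theorem dfsPotential_push [Fintype V] (F : V → Finset V) (stack : List V) (visited : Finset V)
    (rest : V → Finset V) {v : V} (hv : v ∉ visited) (hs : v ∉ stack) :
    dfsPotential F (v :: stack) (insert v visited) (Function.update rest v (F v)) +
      (40 + 2 * (F v).card) = dfsPotential F stack visited rest := by
  have h1 := Finset.add_sum_erase visitedᶜ (fun v => 60 + 22 * (F v).card)
    (Finset.mem_compl.2 hv)
  have h2 : (stack.map fun w => 20 + 20 * (Function.update rest v (F v) w).card) =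
      stack.map fun w => 20 + 20 * (rest w).card :=
    List.map_congr_left fun w hw => by
      rw [Function.update_of_ne]
      rintro rfl
      exact hs hw
  simp only [dfsPotential, Finset.compl_insert, List.map_cons, List.sum_cons, h2, ← h1,
    Function.update_self]
  omega

open scoped Classical in
theorem dfsPotential_erase [Fintype V] (F : V → Finset V) (stack : List V) (visited : Finset V)
    (rest : V → Finset V) {i j : V} (hi : i ∉ stack) (hj : j ∈ rest i) :
    dfsPotential F (i :: stack) visited (Function.update rest i ((rest i).erase j)) + 20 =
      dfsPotential F (i :: stack) visited rest := by
  have h1 := Finset.card_erase_add_one hj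
  have h2 : (stack.map fun w => 20 + 20 *
      (Function.update rest i ((rest i).erase j) w).card) =
      stack.map fun w => 20 + 20 * (rest w).card :=
    List.map_congr_left fun w hw => by
      rw [Function.update_of_ne]
      rintro rfl
      exact hi hw
  simp only [dfsPotential, List.map_cons, List.sum_cons, h2, Function.update_self]
  omega

/-- The fields `N`, `c`, `F` and `B` are the same. -/
def SameGraph (s s' : Memory V U) : Prop := s'.N = s.N ∧ s'.c = s.c ∧ s'.F = s.F ∧ s'.B = s.B

open scoped Classical in
theorem runs_depthFirstSearch [Fintype V] (s : Memory V U) :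
    Runs depthFirstSearch s fun s' m =>
      m ≤ ∑ v, (110 + 22 * (s.F v).card) + 20 ∧ SameGraph s s' ∧ s'.fin.Nodup ∧
        (∀ v, v ∈ s'.fin) ∧ ∀ l, l <:+ s'.fin → ComponentClosed s.F l := by
  refine .block_cons (.bulk (.block_cons (.act (.block_cons (.bulk (.block_cons (.whileTake
    (fun s' => SameGraph s s' ∧ DFSState s.F [] s'.fin s'.visited s'.rest ∧
      ∀ v, v ∈ s'.visited ∨ v ∈ s'.todoV)
    -- The term 30 covers the overhead of a candidate root, including one that is already visited.
    (fun s' => 30 * s'.todoV.card + dfsPotential s.F [] s'.visited s'.rest)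
    ⟨⟨rfl, rfl, rfl, rfl⟩, DFSState.init _ _, by simp⟩ ?_ ?_)))))))
  · rintro s₁ ⟨hG, hD, hV⟩ x hx
    have hcard := Finset.card_erase_add_one hx
    refine .block_cons (.when (fun hvis => .block_cons (.act (.block_cons (.bulk (.block_cons
      (.loop (fun s' => SameGraph s s' ∧ DFSState s.F s'.stack s'.fin s'.visited s'.rest ∧
          (∀ v, v ∈ s'.visited ∨ v ∈ s'.todoV) ∧ s'.todoV = s₁.todoV.erase x)
        (fun s' => dfsPotential s.F s'.stack s'.visited s'.rest) ?_ ?_ ?_)))))) fun hvis =>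
          .block_nil ⟨⟨hG, hD, ?_⟩, ?_⟩)
    · dsimp only at hvis ⊢
      refine ⟨hG, ?_, ?_, rfl⟩
      · rw [hG.2.2.1]
        exact hD.push hvis (by simp)
      · intro v
        by_cases hv : v = x
        · exact .inl (by simp [hv])
        · simpa [hv] using hV v
    · rintro s₂ ⟨hG, hD, hV, hT⟩ hstack
      obtain ⟨i, t, hit⟩ := List.exists_cons_of_ne_nil hstack
      rw [hit] at hD
      have hi : i ∉ t ∧ i ∉ s₂.fin := by
        have := (List.nodup_cons.1 hD.nodup).1
        simpa using this
      refine .block_cons (.first hit (.block_cons (.cond (fun hrest => .act (.block_nil ?_))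
        fun hrest => .block_cons (.pick (Finset.nonempty_iff_ne_empty.2 hrest) fun j hj =>
          .block_cons (.when (fun hjv => .block_cons (.act (.block_cons (.bulk (.block_nil
            (.block_nil (.block_nil ?_))))))) fun hjv => .block_nil (.block_nil ?_))))))
      · dsimp only at hrest ⊢
        rw [hit, List.tail_cons]
        refine ⟨⟨hG, hD.finish hrest, hV, hT⟩, ?_⟩
        simp only [dfsPotential, List.map_cons, List.sum_cons]
        omega
      · dsimp only at hj hjv ⊢
        have hF : s₂.F = s.F := hG.2.2.1
        have h1 := dfsPotential_erase s.F t s₂.visited s₂.rest hi.1 hj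
        have h2 := dfsPotential_push s.F (i :: t) s₂.visited
          (Function.update s₂.rest i ((s₂.rest i).erase j)) hjv
          fun h => hjv ((hD.mem_visited j).2 (.inl h))
        rw [hit, hF]
        refine ⟨⟨⟨hG.1, hG.2.1, rfl, hG.2.2.2⟩, hD.pushChild hjv hj, fun v => ?_, hT⟩, ?_⟩
        · exact (hV v).imp_left Finset.mem_insert_of_mem
        · omega
      · dsimp only at hj hjv ⊢
        have h1 := dfsPotential_erase s.F t s₂.visited s₂.rest hi.1 hj
        rw [hit]
        refine ⟨⟨hG, hD.skip (not_not.1 hjv), hV, hT⟩, ?_⟩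
        omega
    · rintro s₂ m ⟨hG', hD', hV', hT'⟩ hstack hm
      have hnil : s₂.stack = [] := not_not.1 hstack
      refine .block_nil (.block_nil ⟨⟨hG', hnil ▸ hD', hV'⟩, ?_⟩)
      dsimp only at hm hvis ⊢
      have h1 := dfsPotential_push s.F [] s₁.visited s₁.rest hvis (by simp)
      rw [hG.2.2.1] at hm ⊢
      rw [hnil] at hm
      rw [hT']
      omega
    · dsimp only at hvis ⊢
      intro v
      by_cases hv : v = x
      · exact .inl (hv ▸ not_not.1 hvis)
      · simpa [hv] using hV v
    · dsimp only
      omega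
  · rintro s' m ⟨hG, hD, hV⟩ hS hm
    refine .block_nil ⟨?_, hG, hD.nodup, fun v => ?_, hD.suffix_closed⟩
    · simp only [dfsPotential, List.map_nil, List.sum_nil, Finset.compl_empty, Finset.card_univ,
        Finset.sum_add_distrib, Finset.sum_const, smul_eq_mul] at hm ⊢
      omega
    · simpa [hS, hD.mem_visited] using hV v

/-! ### Collecting the components by searches along reversed edges. -/

/-- `O` lists complete strongly connected components in a topological order, and everything from
which its elements can be reached. -/
structure OrderedComponents (F : V → Finset V) (O : List V) : Prop where
  nodup : O.Nodup
  pred_closed : ∀ u ∈ O, ∀ v, Reach F v u → v ∈ O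
  components : ∃ S : List (List V), O = S.flatten ∧
    (∀ K ∈ S, K ≠ [] ∧ ∀ u ∈ K, ∀ v, v ∈ K ↔ Reach F u v ∧ Reach F v u) ∧
    S.Pairwise fun K K' => ∀ u ∈ K, ∀ v ∈ K', ¬ Reach F v u

/-- A state of the search for the component of `r` along reversed edges: `K` is the list of
vertices found and processed, and the predecessors of `i` in `todo` have not been seen yet. -/
structure ReverseSearch (F : V → Finset V) (O : List V) (r : V) (K stack : List V)
    (visited : Finset V) (i : V) (todo : Finset V) : Prop where
  nodup : (K ++ stack).Nodup
  mem_visited : ∀ v, v ∈ visited ↔ v ∈ O ∨ v ∈ K ∨ v ∈ stack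
  notMem : ∀ v, v ∈ K ∨ v ∈ stack → v ∉ O ∧ Reach F r v ∧ Reach F v r
  root_mem : r ∈ K ∨ r ∈ stack
  closed : ∀ x ∈ K, ∀ y, x ∈ F y → y ∈ visited ∨ x = i ∧ y ∈ todo
  todo_pred : ∀ y ∈ todo, i ∈ K ∧ i ∈ F y

namespace ReverseSearch

variable {F B : V → Finset V} {O : List V} {r i : V} {K stack : List V} {visited todo : Finset V}

open scoped Classical in
theorem init (hO : ∀ v, v ∈ visited ↔ v ∈ O) (hr : r ∉ O) (i : V) :
    ReverseSearch F O r [] [r] (insert r visited) i ∅ where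
  nodup := by simp
  mem_visited v := by simp [hO, or_comm]
  notMem v hv := by
    have hv : v = r := by simpa using hv
    subst hv
    exact ⟨hr, .refl, .refl⟩
  root_mem := by simp
  closed := by simp
  todo_pred := by simp

theorem pop {x : V} (h : ReverseSearch F O r K (x :: stack) visited i ∅)
    (hB : ∀ v w, v ∈ B w ↔ w ∈ F v) :
    ReverseSearch F O r (K ++ [x]) stack visited x (B x) where
  nodup := by simpa using h.nodup
  mem_visited v := by
    rw [h.mem_visited, List.mem_append, List.mem_cons, List.mem_singleton, or_assoc]
  notMem v hv := h.notMem v (by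
    rwa [List.mem_append, List.mem_singleton, or_assoc, ← List.mem_cons] at hv)
  root_mem := by
    rw [List.mem_append, List.mem_singleton, or_assoc, ← List.mem_cons]
    exact h.root_mem
  closed y hy z hz := by
    rcases List.mem_append.1 hy with hy | hy
    · exact .inl ((h.closed y hy z hz).resolve_right (by simp))
    · have hy : y = x := by simpa using hy
      subst hy
      exact .inr ⟨rfl, (hB _ _).2 hz⟩
  todo_pred y hy := ⟨by simp, (hB _ _).1 hy⟩

open scoped Classical in
theorem skip {j : V} (h : ReverseSearch F O r K stack visited i todo) (hj : j ∈ visited) :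
    ReverseSearch F O r K stack visited i (todo.erase j) where
  nodup := h.nodup
  mem_visited := h.mem_visited
  notMem := h.notMem
  root_mem := h.root_mem
  closed x hx y hy := by
    by_cases hyj : y = j
    · exact .inl (hyj ▸ hj)
    · exact (h.closed x hx y hy).imp_right fun h' => ⟨h'.1, Finset.mem_erase.2 ⟨hyj, h'.2⟩⟩
  todo_pred y hy := h.todo_pred y (Finset.mem_of_mem_erase hy)

open scoped Classical in
-- The hypothesis `hO` confines the search to the component of `r`: a newly found predecessor
-- reaches `r`, and `hO` supplies the path back.
theorem push {j : V} (h : ReverseSearch F O r K stack visited i todo) (hj : j ∉ visited)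
    (hjt : j ∈ todo) (hO : ∀ u, u ∉ O → Reach F u r → Reach F r u) :
    ReverseSearch F O r K (j :: stack) (insert j visited) i (todo.erase j) where
  nodup := by
    rw [List.nodup_middle, List.nodup_cons, List.mem_append]
    exact ⟨fun hm => hj ((h.mem_visited j).2 (.inr hm)), h.nodup⟩
  mem_visited v := by
    rw [Finset.mem_insert, h.mem_visited, List.mem_cons]
    tauto
  notMem v hv := by
    by_cases hvj : v = j
    · subst hvj
      have hvO : v ∉ O := fun hm => hj ((h.mem_visited v).2 (.inl hm))
      obtain ⟨hi, hif⟩ := h.todo_pred v hjt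
      have hvr : Reach F v r := (h.notMem i (.inl hi)).2.2.head hif
      exact ⟨hvO, hO v hvO hvr, hvr⟩
    · exact h.notMem v (hv.imp_right fun hv => (List.mem_cons.1 hv).resolve_left hvj)
  root_mem := h.root_mem.imp_right (List.mem_cons_of_mem _)
  closed x hx y hy := by
    by_cases hyj : y = j
    · exact .inl (hyj ▸ Finset.mem_insert_self _ _)
    · exact (h.closed x hx y hy).imp (Finset.mem_insert_of_mem ·) fun h' =>
        ⟨h'.1, Finset.mem_erase.2 ⟨hyj, h'.2⟩⟩
  todo_pred y hy := h.todo_pred y (Finset.mem_of_mem_erase hy)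

theorem orderedComponents (h : ReverseSearch F O r K [] visited i ∅)
    (hO : OrderedComponents F O) (hr : ∀ u, u ∉ O → Reach F u r → Reach F r u) :
    OrderedComponents F (O ++ K) := by
  have hrK : r ∈ K := by simpa using h.root_mem
  have hK : ∀ v ∈ K, v ∉ O ∧ Reach F r v ∧ Reach F v r := fun v hv => h.notMem v (.inl hv)
  -- A path into `r` is followed backwards. It never meets `O`, because `O` is closed under
  -- predecessors and `v` is outside it; so each predecessor was recorded in `K`.
  have hcomp : ∀ v, v ∉ O → Reach F v r → v ∈ K := by
    intro v hvO hv
    induction hv using Relation.ReflTransGen.head_induction_on with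
    | refl => exact hrK
    | head hab hbr ih =>
      have hb := ih fun hbO => hvO (hO.pred_closed _ hbO _ (.single hab))
      have := (h.closed _ hb _ hab).resolve_right (by simp)
      simpa [h.mem_visited, hvO] using this
  obtain ⟨S, rfl, hS, hS'⟩ := hO.components
  refine ⟨?_, ?_, S ++ [K], by simp, ?_, ?_⟩
  · refine List.nodup_append'.2 ⟨hO.nodup, by simpa using h.nodup, fun v hv hvK => ?_⟩
    exact (hK v hvK).1 hv
  · intro u hu v hv
    by_cases hvO : v ∈ S.flatten
    · exact List.mem_append_left _ hvO
    · rcases List.mem_append.1 hu with hu | hu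
      · exact absurd (hO.pred_closed u hu v hv) hvO
      · exact List.mem_append_right _ (hcomp v hvO (hv.trans (hK u hu).2.2))
  · intro K' hK'
    rcases List.mem_append.1 hK' with hK' | hK'
    · exact hS K' hK'
    · obtain rfl : K' = K := by simpa using hK'
      refine ⟨List.ne_nil_of_mem hrK, fun u hu v => ⟨fun hv => ?_, fun hv => ?_⟩⟩
      · exact ⟨(hK u hu).2.2.trans (hK v hv).2.1, (hK v hv).2.2.trans (hK u hu).2.1⟩
      · exact hcomp v (fun hvO => (hK u hu).1 (hO.pred_closed v hvO u hv.1))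
          (hv.2.trans (hK u hu).2.2)
  · refine List.pairwise_append.2 ⟨hS', by simp, fun K₁ hK₁ K₂ hK₂ u hu v hv hvu => ?_⟩
    obtain rfl : K₂ = K := by simpa using hK₂
    exact (hK v hv).1 (hO.pred_closed u (List.mem_flatten.2 ⟨K₁, hK₁, hu⟩) v hvu)

end ReverseSearch

/-- The first vertex of `fin` that is not yet listed can reach every unlisted vertex that reaches
it. -/
theorem OrderedComponents.reach_of_reach {F : V → Finset V} {O l : List V} {r : V}
    (hO : OrderedComponents F O) (hl : ComponentClosed F l) (hrl : r ∉ l)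
    (hall : ∀ v, v ∈ O ∨ v ∈ r :: l) {u : V} (hu : u ∉ O) (hur : Reach F u r) : Reach F r u := by
  by_contra hcon
  -- If `r` does not reach `u`, the component of `u` misses `r`. It misses `O` as well, by
  -- predecessor-closedness, so it lies in `l`; then `l` contains `r`, which `u` reaches.
  refine hrl (hl u (fun w huw hwu => ?_) r hur)
  have hwO : w ∉ O := fun hw => hu (hO.pred_closed w hw u huw)
  rcases List.mem_cons.1 ((hall w).resolve_left hwO) with rfl | hw
  · exact absurd hwu hcon
  · exact hw

/-- The potential of the reverse search. -/
noncomputable def reversePotential [Fintype V] (B : V → Finset V) (stack : List V)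
    (visited : Finset V) : ℕ :=
  open scoped Classical in
  -- The share `14 * (B v).card` pays for copying and scanning the predecessors of `v` when it is
  -- popped; pushing `v` releases 30.
  ∑ v ∈ visitedᶜ, (60 + 14 * (B v).card) + (stack.map fun v => 30 + 14 * (B v).card).sum

open scoped Classical in
theorem reversePotential_push [Fintype V] (B : V → Finset V) (stack : List V) {visited : Finset V}
    {v : V} (hv : v ∉ visited) :
    reversePotential B (v :: stack) (insert v visited) + 30 = reversePotential B stack visited := by
  have h1 := Finset.add_sum_erase visitedᶜ (fun v => 60 + 14 * (B v).card)
    (Finset.mem_compl.2 hv)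
  simp only [reversePotential, Finset.compl_insert, List.map_cons, List.sum_cons, ← h1]
  omega

open scoped Classical in
theorem runs_scanPredecessors [Fintype V] {F : V → Finset V} {O : List V} {r : V} {K : List V}
    (hr : ∀ u, u ∉ O → Reach F u r → Reach F r u) (s : Memory V U)
    (hs : ReverseSearch F O r K s.stack s.visited s.i s.todoN) :
    Runs (whileTake (·.todoN) (fun x s => { s with todoN := s.todoN.erase x, j := x }) [
        when (fun s => s.j ∉ s.visited) (act fun s =>
          { s with visited := insert s.j s.visited, stack := s.j :: s.stack })]) s
      fun s' m => m + reversePotential s.B s'.stack s'.visited ≤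
          10 * s.todoN.card + reversePotential s.B s.stack s.visited + 1 ∧
        SameGraph s s' ∧ s'.fin = s.fin ∧ s'.O = s.O ∧
        ReverseSearch F O r K s'.stack s'.visited s'.i ∅ := by
  refine .whileTake
    (fun s' => SameGraph s s' ∧ s'.fin = s.fin ∧ s'.O = s.O ∧
        ReverseSearch F O r K s'.stack s'.visited s'.i s'.todoN)
    (fun s' => 10 * s'.todoN.card + reversePotential s.B s'.stack s'.visited)
    ⟨⟨rfl, rfl, rfl, rfl⟩, rfl, rfl, hs⟩ ?_ ?_
  · rintro s₁ ⟨hG, hfin, hO, hR⟩ x hx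
    have hcard := Finset.card_erase_add_one hx
    refine .block_cons (.when (fun h => .act (.block_nil ?_)) fun h => .block_nil ?_)
    · dsimp only at h ⊢
      refine ⟨⟨hG, hfin, hO, hR.push h hx hr⟩, ?_⟩
      have := reversePotential_push s.B s₁.stack h
      omega
    · dsimp only at h ⊢
      refine ⟨⟨hG, hfin, hO, hR.skip (not_not.1 h)⟩, ?_⟩
      omega
  · rintro s' m ⟨hG, hfin, hO, hR⟩ hS hm
    exact ⟨by omega, hG, hfin, hO, hS ▸ hR⟩

open scoped Classical in
theorem runs_collectComponents [Fintype V] (s : Memory V U) (hB : ∀ v w, v ∈ s.B w ↔ w ∈ s.F v)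
    (hnd : s.fin.Nodup) (hmem : ∀ v, v ∈ s.fin)
    (hcl : ∀ l, l <:+ s.fin → ComponentClosed s.F l) :
    Runs collectComponents s fun s' m =>
      m ≤ ∑ v, (110 + 14 * (s.B v).card) + 20 ∧ SameGraph s s' ∧ (∀ v, v ∈ s'.O) ∧
        OrderedComponents s.F s'.O := by
  have hlen : s.fin.length ≤ Fintype.card V := hnd.length_le_card
  refine .block_cons (.bulk (.block_cons (.act (.block_cons (.loop
    (fun s' => SameGraph s s' ∧ s'.fin <:+ s.fin ∧ (∀ v, v ∈ s'.visited ↔ v ∈ s'.O) ∧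
      (∀ v, v ∈ s'.O ∨ v ∈ s'.fin) ∧ OrderedComponents s.F s'.O)
    (fun s' => 20 * s'.fin.length + reversePotential s.B [] s'.visited)
    ⟨⟨rfl, rfl, rfl, rfl⟩, List.suffix_rfl, by simp, fun v => .inr (hmem v),
      ⟨by simp, by simp, [], by simp⟩⟩ ?_ ?_)))))
  · rintro s₁ ⟨hG, hsuf, hvis, hall, hO⟩ hne
    obtain ⟨r, l, hrl⟩ := List.exists_cons_of_ne_nil hne
    rw [hrl] at hsuf hall
    have hlsuf : l <:+ s.fin := (List.suffix_cons r l).trans hsuf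
    have hrl' : r ∉ l := (List.nodup_cons.1 (hsuf.sublist.nodup hnd)).1
    -- This is where the finishing order of the depth-first search is used, through the suffix `l`
    -- that follows `r`.
    have hr : ∀ u, u ∉ s₁.O → Reach s.F u r → Reach s.F r u := fun u =>
      hO.reach_of_reach (hcl l hlsuf) hrl' hall
    refine .block_cons (.first hrl (.block_cons (.when (fun hv => .block_cons (.act (.block_cons
      (.loop (fun s' => SameGraph s s' ∧ s'.fin = l ∧ ∃ K, s'.O = s₁.O ++ K ∧
          ReverseSearch s.F s₁.O r K s'.stack s'.visited s'.i ∅)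
        (fun s' => reversePotential s.B s'.stack s'.visited) ?_ ?_ ?_)))) fun hv =>
          .block_nil ?_)))
    · dsimp only at hv ⊢
      rw [hvis] at hv
      exact ⟨hG, by rw [hrl, List.tail_cons], [], by simp, .init hvis hv _⟩
    · rintro s₂ ⟨hG₂, hfin, K, hK, hR⟩ hstack
      obtain ⟨x, t, hxt⟩ := List.exists_cons_of_ne_nil hstack
      rw [hxt] at hR
      have hB₂ : s₂.B = s.B := hG₂.2.2.2
      refine .block_cons (.first hxt (.block_cons (.bulk (.block_cons
        ((runs_scanPredecessors (K := K ++ [x]) hr _ ?_).mono ?_)))))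
      · dsimp only
        rw [hxt, hB₂]
        exact hR.pop hB
      · rintro s₃ m ⟨hm, hG₃, hfin₃, hO₃, hR₃⟩
        dsimp only at hm hfin₃ hO₃ ⊢
        refine .block_nil ⟨⟨⟨hG₃.1.trans hG₂.1, hG₃.2.1.trans hG₂.2.1, hG₃.2.2.1.trans hG₂.2.2.1,
          hG₃.2.2.2.trans hG₂.2.2.2⟩, hfin₃.trans hfin, K ++ [x], ?_, hR₃⟩, ?_⟩
        · rw [hO₃, hK, List.append_assoc]
        · rw [hxt, hB₂, List.tail_cons] at hm
          rw [hxt, hB₂]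
          have : reversePotential s.B (x :: t) s₂.visited =
              reversePotential s.B t s₂.visited + (30 + 14 * (s.B x).card) := by
            simp only [reversePotential, List.map_cons, List.sum_cons]
            omega
          omega
    · rintro s₂ m ⟨hG₂, hfin, K, hK, hR⟩ hstack hm
      rw [not_not.1 hstack] at hR hm
      dsimp only at hv hm ⊢
      have h1 := reversePotential_push s.B s₁.stack hv
      have h2 := reversePotential_push s.B [] hv
      refine .block_nil (.block_nil ⟨⟨hG₂, hfin ▸ hlsuf, fun v => ?_, fun v => ?_, ?_⟩, ?_⟩)
      · rw [hR.mem_visited, hK]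
        simp
      · rw [hK, hfin, List.mem_append]
        have hrm : r ∈ K := by simpa using hR.root_mem
        rcases hall v with h | h
        · exact .inl (.inl h)
        · rcases List.mem_cons.1 h with rfl | h
          · exact .inl (.inr hrm)
          · exact .inr h
      · rw [hK]
        exact hR.orderedComponents hO hr
      · rw [hfin, hrl, List.length_cons]
        omega
    · dsimp only at hv ⊢
      have hrO : r ∈ s₁.O := (hvis r).1 (not_not.1 hv)
      rw [hrl, List.tail_cons]
      refine ⟨⟨hG, hlsuf, hvis, fun v => ?_, hO⟩, ?_⟩
      · rcases hall v with h | h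
        · exact .inl h
        · rcases List.mem_cons.1 h with rfl | h
          · exact .inl hrO
          · exact .inr h
      · rw [List.length_cons]
        omega
  · rintro s' m ⟨hG, hsuf, hvis, hall, hO⟩ hfin hm
    rw [not_not] at hfin
    refine .block_nil ⟨?_, hG, fun v => ?_, hO⟩
    · simp only [reversePotential, List.map_nil, List.sum_nil, Finset.compl_empty,
        Finset.card_univ, Finset.sum_add_distrib, Finset.sum_const, smul_eq_mul] at hm ⊢
      omega
    · simpa [hfin] using hall v

/-! ### Redirecting an edge of the constraint graph, and the cost of a substitution. -/

open scoped Classical in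
/-- The constraint graph after the edge `{j, k}` has been replaced by `{i, k}`. -/
noncomputable def redirect (N : V → Finset V) (i j k : V) : V → Finset V :=
  -- The updates follow the four final assignments of `substitute` one by one, so that the two agree
  -- by unfolding.
  let N₁ := Function.update N j ((N j).erase k)
  let N₂ := Function.update N₁ k ((N₁ k).erase j)
  let N₃ := Function.update N₂ i (insert k (N₂ i))
  Function.update N₃ k (insert i (N₃ k))

section redirect

variable {N : V → Finset V} {i j k : V}

open scoped Classical in
theorem redirect_source (hij : i ≠ j) (hjk : j ≠ k) : redirect N i j k j = (N j).erase k := by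
  simp [redirect, hij.symm, hjk]

open scoped Classical in
theorem redirect_target (hik : i ≠ k) (hjk : j ≠ k) :
    redirect N i j k k = insert i ((N k).erase j) := by
  simp [redirect, hik.symm, hjk.symm]

open scoped Classical in
theorem redirect_root (hij : i ≠ j) (hik : i ≠ k) : redirect N i j k i = insert k (N i) := by
  simp [redirect, hij, hik]

theorem redirect_of_ne {v : V} (hi : v ≠ i) (hj : v ≠ j) (hk : v ≠ k) :
    redirect N i j k v = N v := by
  simp [redirect, hi, hj, hk]

theorem mem_redirect (hij : i ≠ j) (hik : i ≠ k) (hjk : j ≠ k) (v w : V) :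
    w ∈ redirect N i j k v ↔
      (w ∈ N v ∧ ¬ (v = j ∧ w = k) ∧ ¬ (v = k ∧ w = j)) ∨ v = i ∧ w = k ∨ v = k ∧ w = i := by
  classical
  by_cases h1 : v = i
  · subst h1
    rw [redirect_root hij hik, Finset.mem_insert]
    simp only [hij, hik, false_and, not_false_eq_true, and_true, true_and, or_false]
    exact or_comm
  by_cases h2 : v = j
  · subst h2
    rw [redirect_source hij hjk, Finset.mem_erase]
    simp only [h1, hjk, false_and, not_false_eq_true, and_true, true_and, or_false]
    exact and_comm
  by_cases h3 : v = k
  · subst h3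
    rw [redirect_target hik hjk, Finset.mem_insert, Finset.mem_erase]
    simp only [h1, h2, false_and, not_false_eq_true, true_and, false_or]
    rw [or_comm, and_comm]
  · simp [redirect_of_ne h1 h2 h3, h1, h2, h3]

/-- `k` exchanges its neighbour `j` for `i`, `j` loses one, and all others but the root are
untouched. This is why the substitutions can be charged to degrees. -/
theorem card_redirect_le (hij : i ≠ j) (hik : i ≠ k) (hjk : j ≠ k) (hk : j ∈ N k) {v : V}
    (hv : v ≠ i) : (redirect N i j k v).card ≤ (N v).card := by
  classical
  by_cases h2 : v = j
  · subst h2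
    rw [redirect_source hij hjk]
    exact Finset.card_erase_le
  by_cases h3 : v = k
  · subst h3
    rw [redirect_target hik hjk]
    exact (Finset.card_insert_le _ _).trans (Finset.card_erase_add_one hk).le
  · rw [redirect_of_ne hv h2 h3]

theorem card_redirect_source (hij : i ≠ j) (hjk : j ≠ k) (hk : k ∈ N j) :
    (redirect N i j k j).card + 1 = (N j).card := by
  classical
  rw [redirect_source hij hjk]
  exact Finset.card_erase_add_one hk

end redirect

/-- The fields used by the control structure of the elimination, except for `N`, are the same. -/
def SameControl (s s' : Memory V U) : Prop :=
  s'.F = s.F ∧ s'.O = s.O ∧ s'.eliminated = s.eliminated ∧ s'.L = s.L ∧ s'.i = s.i ∧ s'.j = s.j ∧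
    s'.k = s.k

open scoped Classical in
theorem runs_substitute (D : V → Finset U) {d : ℕ} (hd : ∀ i, (D i).card ≤ d) (h0 : 0 < d)
    (s : Memory V U) :
    Runs (substitute D) s fun s' m =>
      m ≤ 80 * d ^ 2 ∧ SameControl s s' ∧ s'.N = redirect s.N s.i s.j s.k := by
  refine .block_cons (.bulk (.block_cons (.whileTake
    (fun s' => SameControl s s' ∧ s'.N = s.N) (fun s' => (20 * d + 25) * s'.todoA.card)
    ⟨⟨rfl, rfl, rfl, rfl, rfl, rfl, rfl⟩, rfl⟩ ?_ ?_)))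
  · rintro s₁ ⟨hC, hN⟩ x hx
    have hcard := Finset.card_erase_add_one hx
    refine .block_cons (.act (.block_cons (.bulk (.block_cons (.whileTake
      (fun s' => SameControl s s' ∧ s'.N = s.N ∧ s'.todoA = s₁.todoA.erase x)
      (fun s' => 8 * s'.todoB.card) ⟨hC, hN, rfl⟩ ?_ ?_)))))
    · rintro s₂ ⟨hC, hN, hA⟩ y hy
      have hcard := Finset.card_erase_add_one hy
      refine .block_cons (.when (fun h => .act (.block_nil ?_)) fun h => .block_nil ?_) <;>
      · dsimp only
        exact ⟨⟨hC, hN, hA⟩, by omega⟩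
    · rintro s₂ m₂ ⟨hC, hN, hA⟩ hS₂ hm₂
      refine .block_cons (.bulk (.block_cons (.whileTake
        (fun s' => SameControl s s' ∧ s'.N = s.N ∧ s'.todoA = s₁.todoA.erase x)
        (fun s' => 8 * s'.todoB.card) ⟨hC, hN, hA⟩ ?_ ?_)))
      · rintro s₃ ⟨hC, hN, hA⟩ y hy
        have hcard := Finset.card_erase_add_one hy
        refine .block_cons (.act (.block_nil ?_))
        dsimp only
        exact ⟨⟨hC, hN, hA⟩, by omega⟩
      · rintro s₃ m₃ ⟨hC, hN, hA⟩ hS₃ hm₃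
        refine .block_nil ⟨⟨hC, hN⟩, ?_⟩
        dsimp only at hm₂ hm₃ ⊢
        have h1 := hd s₁.j
        have h2 := hd s₂.k
        rw [hA, ← hcard, mul_add]
        omega
  · rintro s₁ m ⟨⟨hF, hO, he, hL, hi, hj, hk⟩, hN⟩ hS hm
    refine .block_cons (.act (.block_cons (.act (.block_cons (.act (.block_cons (.act
      (.block_nil ⟨?_, ⟨hF, hO, he, hL, hi, hj, hk⟩, ?_⟩))))))))
    · have h1 := hd s.i
      dsimp only at hm ⊢
      nlinarith [Nat.mul_le_mul_left (20 * d + 25) h1]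
    · simp only [redirect, hN, hi, hj, hk]

/-! ### The invariants of the elimination and the role of the ordering. -/

/-- The invariant of the elimination between two phases: `O` lists the variables that are still to
be considered. -/
structure BetweenPhases (F N : V → Finset V) (O : List V) (elim : Finset V) : Prop where
  symm : ∀ v, ∀ w ∈ N v, v ∈ N w
  irrefl : ∀ v, v ∉ N v
  -- An eliminated variable may keep the constraint with its root; this is harmless because the root
  -- has left `O`.
  isolated : ∀ v ∈ elim, ∀ w ∈ N v, w ∈ O → w ∈ elim
  -- A constraint that was functional in the input disappears only together with one of its ends, so
  -- the current neighbour lists suffice to find all functional edges still needed.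
  keep : ∀ v, ∀ w ∈ F v, w ∈ N v ∨ v ∈ elim ∨ w ∈ elim
  closed : ∀ v, v ∉ O ∨ v ∈ elim → ∀ w ∈ F v, w ∉ O ∨ w ∈ elim

/-- The invariant of the phase of the root `i`; `X` holds of the variable that is currently being
eliminated, if there is one. -/
structure InPhase (F N : V → Finset V) (O : List V) (elim L : Finset V) (i : V) (X : V → Prop) :
    Prop where
  symm : ∀ v, ∀ w ∈ N v, v ∈ N w
  irrefl : ∀ v, v ∉ N v
  isolated : ∀ v ∈ elim, ∀ w ∈ N v, w ∈ O → w ∈ elim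
  keep : ∀ v, ∀ w ∈ F v, w ∈ N v ∨ v ∈ elim ∨ w ∈ elim ∨ X v ∨ X w
  closed : ∀ v, v ∉ O ∨ v ∈ elim → ∀ w ∈ F v, w ∉ O ∨ w ∈ elim ∨ w ∈ L ∨ X w
  root_notMem : i ∉ elim
  listed : ∀ v ∈ L, v ∈ O ∧ v ∉ elim ∧ Reach F i v ∧ ¬ X v
  current : ∀ v, X v → v ∈ O ∧ v ∉ elim ∧ Reach F i v ∧
    ∀ w ∈ F v, w ∈ N v ∨ w ∉ O ∨ w ∈ elim ∨ w ∈ L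

namespace BetweenPhases

variable {F N : V → Finset V} {O : List V} {elim : Finset V} {i : V}

theorem skip (h : BetweenPhases F N (i :: O) elim) (hi : i ∈ elim) : BetweenPhases F N O elim where
  symm := h.symm
  irrefl := h.irrefl
  isolated v hv w hw hwO := h.isolated v hv w hw (List.mem_cons_of_mem _ hwO)
  keep := h.keep
  closed v hv w hw := by
    refine (h.closed v ?_ w hw).imp_left fun h' hwO => h' (List.mem_cons_of_mem _ hwO)
    by_cases hvi : v = i
    · exact .inr (hvi ▸ hi)
    · exact hv.imp_left fun h' hv' => h' ((List.mem_cons.1 hv').resolve_left hvi)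

theorem closed_reach (h : BetweenPhases F N O elim) {v w : V} (hvw : Reach F v w)
    (hv : v ∉ O ∨ v ∈ elim) : w ∉ O ∨ w ∈ elim := by
  induction hvw with
  | refl => exact hv
  | tail _ hw ih => exact h.closed _ ih _ hw

/-- In a functional elimination ordering, the variables that can be reached from a root have not yet
been considered. -/
theorem mem_of_reach {O₀ : List V} (h : BetweenPhases F N (i :: O) elim) (hi : i ∉ elim)
    (hmem : ∀ v, v ∈ O₀) (hO₀ : O₀.Pairwise fun v w => Reach F v w ∨ Reach F w v → Reach F v w)
    (hs : i :: O <:+ O₀) {v : V} (hv : Reach F i v) (hne : v ≠ i) : v ∈ O := by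
  by_contra hvO
  obtain ⟨l, rfl⟩ := hs
  have hvl : v ∈ l := by simpa [hne, hvO] using hmem v
  -- The defining property of the ordering turns the path from `i` to the earlier `v` into a path
  -- from `v` to `i`; closedness then makes `i` eliminated.
  have hback := (List.pairwise_append.1 hO₀).2.2 v hvl i List.mem_cons_self (.inr hv)
  have := h.closed_reach hback (.inl (by simp [hne, hvO]))
  simp [hi] at this

open scoped Classical in
-- When `i` leaves `O`, closedness could fail only at the functional edges out of `i`. By `keep`,
-- the targets not yet eliminated are still neighbours of `i`, hence in the initial worklist.
theorem start (h : BetweenPhases F N (i :: O) elim) (hi : i ∉ elim) (hiO : i ∉ O)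
    (hreach : ∀ v, Reach F i v → v ≠ i → v ∈ O) :
    InPhase F N O elim ((N i).filter fun v => v ∈ F i) i fun _ => False where
  symm := h.symm
  irrefl := h.irrefl
  isolated v hv w hw hwO := h.isolated v hv w hw (List.mem_cons_of_mem _ hwO)
  keep v w hw := (h.keep v w hw).imp_right (·.imp_right .inl)
  closed v hv w hw := by
    by_cases hvi : v = i
    · subst hvi
      rcases h.keep v w hw with h' | h' | h'
      · exact .inr (.inr (.inl (Finset.mem_filter.2 ⟨h', hw⟩)))
      · exact absurd h' hi
      · exact .inr (.inl h')
    · have hv' : v ∉ i :: O ∨ v ∈ elim :=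
        hv.imp_left fun h' hv' => h' ((List.mem_cons.1 hv').resolve_left hvi)
      rcases h.closed v hv' w hw with h' | h'
      · exact .inl fun hwO => h' (List.mem_cons_of_mem _ hwO)
      · exact .inr (.inl h')
  root_notMem := hi
  listed v hv := by
    rw [Finset.mem_filter] at hv
    have hne : v ≠ i := by
      rintro rfl
      exact h.irrefl _ hv.1
    have hr : Reach F i v := .single hv.2
    exact ⟨hreach v hr hne,
      fun hve => hi (h.isolated v hve i (h.symm _ _ hv.1) List.mem_cons_self), hr, not_false⟩
  current _ h' := h'.elim

end BetweenPhases

namespace InPhase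

variable {F N : V → Finset V} {O : List V} {elim L : Finset V} {i j k : V}

theorem finish (h : InPhase F N O elim ∅ i fun _ => False) : BetweenPhases F N O elim where
  symm := h.symm
  irrefl := h.irrefl
  isolated := h.isolated
  keep v w hw := by simpa using h.keep v w hw
  closed v hv w hw := by simpa using h.closed v hv w hw

open scoped Classical in
theorem take (h : InPhase F N O elim L i fun _ => False) (hj : j ∈ L) :
    InPhase F N O elim (L.erase j) i (· = j) where
  symm := h.symm
  irrefl := h.irrefl
  isolated := h.isolated
  keep v w hw := by
    have := h.keep v w hw
    tauto
  closed v hv w hw := by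
    have := h.closed v hv w hw
    rw [Finset.mem_erase]
    tauto
  root_notMem := h.root_notMem
  listed v hv := by
    rw [Finset.mem_erase] at hv
    have := h.listed v hv.2
    tauto
  current v hv := by
    subst hv
    obtain ⟨h1, h2, h3, -⟩ := h.listed v hj
    refine ⟨h1, h2, h3, fun w hw => ?_⟩
    rcases h.keep v w hw with h' | h' | h' | h' | h'
    · exact .inl h'
    · exact absurd h' h2
    · exact .inr (.inr (.inl h'))
    · exact h'.elim
    · exact h'.elim

open scoped Classical in
-- Once only `i` may remain as a neighbour of `j`, every functional edge out of `j` ends at a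
-- variable that is outside `O`, eliminated or in `L`, so `j` may join the closed set.
theorem eliminate (h : InPhase F N O elim L i (· = j)) (hiO : i ∉ O)
    (hN : ∀ k ∈ N j, k = i) : InPhase F N O (insert j elim) L i fun _ => False where
  symm := h.symm
  irrefl := h.irrefl
  isolated v hv w hw hwO := by
    rcases Finset.mem_insert.1 hv with rfl | hv
    · exact absurd (hN w hw ▸ hwO) hiO
    · exact Finset.mem_insert_of_mem (h.isolated v hv w hw hwO)
  keep v w hw := by
    have := h.keep v w hw
    simp only [Finset.mem_insert]
    tauto
  closed v hv w hw := by
    simp only [Finset.mem_insert] at hv ⊢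
    by_cases hvj : v = j
    · subst hvj
      rcases (h.current v rfl).2.2.2 w hw with h' | h' | h' | h'
      · exact .inl (hN w h' ▸ hiO)
      · exact .inl h'
      · exact .inr (.inl (.inr h'))
      · exact .inr (.inr (.inl h'))
    · have := h.closed v (by tauto) w hw
      tauto
  root_notMem := by
    rw [Finset.mem_insert, not_or]
    refine ⟨?_, h.root_notMem⟩
    rintro rfl
    exact hiO (h.current i rfl).1
  listed v hv := by
    obtain ⟨h1, h2, h3, h4⟩ := h.listed v hv
    exact ⟨h1, by simp [h2, h4], h3, not_false⟩
  current _ h' := h'.elim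

theorem ne_current (h : InPhase F N O elim L i (· = j)) (hiO : i ∉ O) : i ≠ j := by
  rintro rfl
  exact hiO (h.current i rfl).1

theorem notMem_of_mem_current (h : InPhase F N O elim L i (· = j)) (hk : k ∈ N j) : k ∉ elim :=
  fun hke => (h.current j rfl).2.1 (h.isolated k hke j (h.symm _ _ hk) (h.current j rfl).1)

open scoped Classical in
-- The lost edge ends in the current variable, so `keep` survives. If `k ∈ F j`, then `k` is
-- reachable from `i`, so it belongs to `O` by `hreach`, and it is not eliminated, being a neighbour
-- of `j`; hence it may enter `L`.
theorem redirect (h : InPhase F N O elim L i (· = j)) (hiO : i ∉ O)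
    (hreach : ∀ v, Reach F i v → v ≠ i → v ∈ O) (hk : k ∈ N j) (hki : k ≠ i) :
    InPhase F (redirect N i j k) O elim (if k ∈ F j then insert k L else L) i (· = j) := by
  have hij := h.ne_current hiO
  have hjk : j ≠ k := by
    rintro rfl
    exact h.irrefl _ hk
  have hke := h.notMem_of_mem_current hk
  have hcur := h.current j rfl
  have hL : ∀ v, v ∈ L → v ∈ if k ∈ F j then insert k L else L := by
    intro v hv
    split_ifs
    · exact Finset.mem_insert_of_mem hv
    · exact hv
  have hmem := mem_redirect (N := N) hij hki.symm hjk
  refine ⟨fun v w hw => ?_, fun v hv => ?_, fun v hv w hw hwO => ?_, fun v w hw => ?_,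
    fun v hv w hw => ?_, h.root_notMem, fun v hv => ?_, fun v hv => ?_⟩
  · rw [hmem] at hw ⊢
    rcases hw with ⟨h1, h2, h3⟩ | h' | h'
    · exact .inl ⟨h.symm v w h1, fun h' => h3 h'.symm, fun h' => h2 h'.symm⟩
    · exact .inr (.inr h'.symm)
    · exact .inr (.inl h'.symm)
  · rcases (hmem v v).1 hv with h' | ⟨h1, h2⟩ | ⟨h1, h2⟩
    · exact h.irrefl v h'.1
    · exact hki (h2.symm.trans h1)
    · exact hki (h1.symm.trans h2)
  · rcases (hmem v w).1 hw with h' | ⟨h1, h2⟩ | ⟨h1, h2⟩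
    · exact h.isolated v hv w h'.1 hwO
    · exact absurd (h1 ▸ hv) h.root_notMem
    · exact absurd (h1 ▸ hv) hke
  · rcases h.keep v w hw with h' | h'
    · by_cases hvj : v = j
      · exact .inr (.inr (.inr (.inl hvj)))
      by_cases hwj : w = j
      · exact .inr (.inr (.inr (.inr hwj)))
      · exact .inl ((hmem v w).2 (.inl ⟨h', by tauto, by tauto⟩))
    · exact .inr h'
  · exact (h.closed v hv w hw).imp_right (·.imp_right (·.imp_left (hL w)))
  · by_cases hvL : v ∈ L
    · exact h.listed v hvL
    · split_ifs at hv with hkF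
      · obtain rfl : v = k := (Finset.mem_insert.1 hv).resolve_right hvL
        have hr : Reach F i v := hcur.2.2.1.tail hkF
        exact ⟨hreach v hr hki, hke, hr, hjk.symm⟩
      · exact absurd hv hvL
  · subst hv
    refine ⟨hcur.1, hcur.2.1, hcur.2.2.1, fun w hw => ?_⟩
    rcases hcur.2.2.2 w hw with h' | h' | h' | h'
    · by_cases hwk : w = k
      · subst hwk
        simp [hw]
      · exact .inl ((hmem v w).2 (.inl ⟨h', by tauto, by tauto⟩))
    · exact .inr (.inl h')
    · exact .inr (.inr (.inl h'))
    · exact .inr (.inr (.inr (hL w h')))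

end InPhase

/-! ### The potential of the elimination and the cost of step 2. -/

/-- The potential of the elimination: the weight of the variables that are neither considered nor
eliminated. -/
noncomputable def elimPotential (W : ℕ) (N : V → Finset V) (O : List V) (elim : Finset V) : ℕ :=
  open scoped Classical in ∑ v ∈ O.toFinset \ elim, (60 + W * (N v).card)

/-- `j` is counted and loses a neighbour, while the only variable that can gain one is `i`, which is
not counted. -/
theorem elimPotential_redirect {W : ℕ} {N : V → Finset V} {O : List V} {elim : Finset V}
    {i j k : V} (hi : i ∉ O) (hj : j ∈ O) (hje : j ∉ elim) (hik : i ≠ k) (hjk : j ≠ k)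
    (hk : k ∈ N j) (hk' : j ∈ N k) :
    elimPotential W (redirect N i j k) O elim + W ≤ elimPotential W N O elim := by
  classical
  have hij : i ≠ j := by
    rintro rfl
    exact hi hj
  have hjA : j ∈ O.toFinset \ elim := by simp [hj, hje]
  unfold elimPotential
  rw [← Finset.add_sum_erase _ _ hjA, ← Finset.add_sum_erase _ (fun v => 60 + W * (N v).card) hjA,
    ← card_redirect_source hij hjk hk, mul_add]
  have : ∑ v ∈ (O.toFinset \ elim).erase j, (60 + W * (redirect N i j k v).card) ≤
      ∑ v ∈ (O.toFinset \ elim).erase j, (60 + W * (N v).card) := by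
    refine Finset.sum_le_sum fun v hv => ?_
    have hvi : v ≠ i := by
      rintro rfl
      simp [hi] at hv
    exact Nat.add_le_add_left (Nat.mul_le_mul_left _ (card_redirect_le hij hik hjk hk' hvi)) _
  omega

open scoped Classical in
theorem elimPotential_insert {W : ℕ} {N : V → Finset V} {O : List V} {elim : Finset V} {j : V}
    (hj : j ∈ O) (hje : j ∉ elim) :
    elimPotential W N O (insert j elim) + 60 ≤ elimPotential W N O elim := by
  have hjA : j ∈ O.toFinset \ elim := by simp [hj, hje]
  unfold elimPotential
  rw [← Finset.add_sum_erase _ _ hjA, Finset.sdiff_insert]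
  omega

theorem elimPotential_cons {W : ℕ} {N : V → Finset V} {O : List V} {elim : Finset V} {i : V}
    (hi : i ∉ O) (hie : i ∉ elim) :
    elimPotential W N (i :: O) elim = 60 + W * (N i).card + elimPotential W N O elim := by
  classical
  unfold elimPotential
  rw [List.toFinset_cons, Finset.insert_sdiff_of_notMem _ hie, Finset.sum_insert (by simp [hi])]

theorem elimPotential_le_cons {W : ℕ} {N : V → Finset V} {O : List V} {elim : Finset V} {i : V} :
    elimPotential W N O elim ≤ elimPotential W N (i :: O) elim := by
  classical
  unfold elimPotential
  refine Finset.sum_le_sum_of_subset (Finset.sdiff_subset_sdiff ?_ subset_rfl)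
  rw [List.toFinset_cons]
  exact Finset.subset_insert _ _

/-- The fields `F`, `O` and `i` are the same. -/
def SamePhase (s s' : Memory V U) : Prop := s'.F = s.F ∧ s'.O = s.O ∧ s'.i = s.i

open scoped Classical in
theorem runs_eliminateVariable (D : V → Finset U) {d : ℕ} (hd : ∀ i, (D i).card ≤ d) (h0 : 0 < d)
    {i j : V} (s : Memory V U) (hsi : s.i = i) (hsj : s.j = j) (hiO : i ∉ s.O)
    (hreach : ∀ v, Reach s.F i v → v ≠ i → v ∈ s.O)
    (hs : InPhase s.F s.N s.O s.eliminated s.L i (· = j)) :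
    Runs (loop (fun s => ∃ k ∈ s.N s.j, k ≠ s.i) (block [
          pick (fun s => (s.N s.j).erase s.i) (fun x s => { s with k := x }),
          substitute D,
          when (fun s => s.k ∈ s.F s.j) (act fun s => { s with L := insert s.k s.L })])) s
      fun s' m => m + elimPotential (120 * d ^ 2) s'.N s.O s.eliminated ≤
          elimPotential (120 * d ^ 2) s.N s.O s.eliminated + 1 ∧
        SamePhase s s' ∧ s'.eliminated = s.eliminated ∧ s'.j = j ∧ (∀ k ∈ s'.N j, k = i) ∧
        InPhase s.F s'.N s.O s.eliminated s'.L i (· = j) := by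
  have hd2 : 0 < d ^ 2 := by positivity
  refine .loop (fun s' => SamePhase s s' ∧ s'.eliminated = s.eliminated ∧ s'.j = j ∧
      InPhase s.F s'.N s.O s.eliminated s'.L i (· = j))
    -- The weight `120 * d ^ 2` per neighbour exceeds the bound `80 * d ^ 2` for `substitute` enough
    -- to cover the loop overhead, as `d ^ 2` is positive.
    (fun s' => elimPotential (120 * d ^ 2) s'.N s.O s.eliminated)
    ⟨⟨rfl, rfl, rfl⟩, rfl, hsj, hs⟩ ?_ ?_
  · rintro s₁ ⟨⟨hF, hO, hi⟩, he, hj, hP⟩ ⟨k₀, hk₀, hki₀⟩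
    refine .block_cons (.pick ⟨k₀, Finset.mem_erase.2 ⟨hki₀, hk₀⟩⟩ fun k hk => .block_cons
      ((runs_substitute D hd h0 _).mono ?_))
    rintro s₂ m ⟨hm, ⟨hF₂, hO₂, he₂, hL₂, hi₂, hj₂, hk₂⟩, hN₂⟩
    dsimp only at hF₂ hO₂ he₂ hL₂ hi₂ hj₂ hk₂ hN₂
    rw [hi, hsi, hj] at hN₂
    rw [Finset.mem_erase, hi, hsi, hj] at hk
    have hP₂ := hP.redirect hiO hreach hk.2 hk.1
    have hcur := hP.current j rfl
    have hjk : j ≠ k := by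
      rintro rfl
      exact hP.irrefl _ hk.2
    have hpot := elimPotential_redirect (W := 120 * d ^ 2) hiO hcur.1 hcur.2.1 hk.1.symm hjk hk.2
      (hP.symm _ _ hk.2)
    rw [← hN₂] at hP₂ hpot
    have hcond : s₂.k ∈ s₂.F s₂.j ↔ k ∈ s.F j := by rw [hk₂, hF₂, hj₂, hF, hj]
    refine .block_cons (.when (fun h => .act (.block_nil ⟨⟨⟨hF₂.trans hF, hO₂.trans hO,
        hi₂.trans hi⟩, he₂.trans he, hj₂.trans hj, ?_⟩, ?_⟩)) fun h => .block_nil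
        ⟨⟨⟨hF₂.trans hF, hO₂.trans hO, hi₂.trans hi⟩, he₂.trans he, hj₂.trans hj, ?_⟩, ?_⟩)
    · rw [if_pos (hcond.1 h)] at hP₂
      dsimp only
      rwa [hk₂, hL₂]
    · dsimp only
      omega
    · rw [if_neg (mt hcond.2 h)] at hP₂
      rwa [hL₂]
    · omega
  · rintro s' m ⟨hS, he, hj, hP⟩ hex hm
    refine ⟨hm, hS, he, hj, fun k hk => ?_, hP⟩
    by_contra hne
    refine hex ⟨k, hj ▸ hk, ?_⟩
    rw [hS.2.2, hsi]
    exact hne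

open scoped Classical in
theorem runs_phase (D : V → Finset U) {d : ℕ} (hd : ∀ i, (D i).card ≤ d) (h0 : 0 < d)
    {i : V} (s : Memory V U) (hsi : s.i = i) (hi : i ∉ s.eliminated) (hiO : i ∉ s.O)
    (hreach : ∀ v, Reach s.F i v → v ≠ i → v ∈ s.O)
    (hs : BetweenPhases s.F s.N (i :: s.O) s.eliminated) :
    Runs (block [
      act fun s => { s with L := ∅ },
      bulk (fun s => (s.N s.i).card) fun s => { s with todoN := s.N s.i },
      whileTake (·.todoN) (fun x s => { s with todoN := s.todoN.erase x, j := x }) [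
        when (fun s => s.j ∈ s.F s.i) (act fun s => { s with L := insert s.j s.L })],
      whileTake (·.L) (fun x s => { s with L := s.L.erase x, j := x }) [
        loop (fun s => ∃ k ∈ s.N s.j, k ≠ s.i) (block [
          pick (fun s => (s.N s.j).erase s.i) (fun x s => { s with k := x }),
          substitute D,
          when (fun s => s.k ∈ s.F s.j) (act fun s => { s with L := insert s.k s.L })]),
        act fun s => { s with eliminated := insert s.j s.eliminated }]]) s
      fun s' m => m + elimPotential (120 * d ^ 2) s'.N s.O s'.eliminated ≤
          elimPotential (120 * d ^ 2) s.N s.O s.eliminated + 10 * (s.N i).card + 20 ∧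
        s'.F = s.F ∧ s'.O = s.O ∧ BetweenPhases s.F s'.N s.O s'.eliminated := by
  refine .block_cons (.act (.block_cons (.bulk (.block_cons (.whileTake
    (fun s' => SamePhase s s' ∧ s'.eliminated = s.eliminated ∧ s'.N = s.N ∧ s'.todoN ⊆ s.N i ∧
      s'.L = (s.N i \ s'.todoN).filter fun v => v ∈ s.F i)
    (fun s' => 9 * s'.todoN.card) ⟨⟨rfl, rfl, rfl⟩, rfl, rfl, ?_, ?_⟩ ?_ ?_)))))
  · simp [hsi]
  · simp [hsi]
  · rintro s₁ ⟨⟨hF₁, hO₁, hi₁⟩, he₁, hN₁, hT, hL₁⟩ x hx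
    have hcard := Finset.card_erase_add_one hx
    have hins : s.N i \ s₁.todoN.erase x = insert x (s.N i \ s₁.todoN) :=
      Finset.sdiff_erase (hT hx)
    have hsub := (Finset.erase_subset x s₁.todoN).trans hT
    refine .block_cons (.when (fun h => .act (.block_nil
      ⟨⟨⟨hF₁, hO₁, hi₁⟩, he₁, hN₁, hsub, ?_⟩, ?_⟩)) fun h => .block_nil
      ⟨⟨⟨hF₁, hO₁, hi₁⟩, he₁, hN₁, hsub, ?_⟩, ?_⟩)
    · dsimp only at h ⊢
      rw [hF₁, hi₁, hsi] at h
      rw [hins, hL₁, Finset.filter_insert, if_pos h]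
    · dsimp only
      omega
    · dsimp only at h ⊢
      rw [hF₁, hi₁, hsi] at h
      rw [hins, hL₁, Finset.filter_insert, if_neg h]
    · dsimp only
      omega
  · rintro s₁ m₁ ⟨⟨hF₁, hO₁, hi₁⟩, he₁, hN₁, -, hL₁⟩ hS₁ hm₁
    have hP₁ := hs.start hi hiO hreach
    rw [hS₁, Finset.sdiff_empty] at hL₁
    refine .block_cons (.whileTake
      (fun s' => SamePhase s s' ∧ InPhase s.F s'.N s.O s'.eliminated s'.L i fun _ => False)
      (fun s' => elimPotential (120 * d ^ 2) s'.N s.O s'.eliminated)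
      ⟨⟨hF₁, hO₁, hi₁⟩, ?_⟩ ?_ ?_)
    · rw [he₁, hN₁, hL₁]
      exact hP₁
    · rintro s₂ ⟨⟨hF₂, hO₂, hi₂⟩, hP₂⟩ j hj
      have hP₃ := hP₂.take hj
      have hcur := hP₃.current j rfl
      refine .block_cons ((runs_eliminateVariable D hd h0 (i := i) (j := j) _
        (by exact hi₂.trans hsi) rfl ?_ ?_ ?_).mono ?_)
      · dsimp only
        rwa [hO₂]
      · dsimp only
        rwa [hO₂, hF₂]
      · dsimp only
        rwa [hO₂, hF₂]
      · rintro s₃ m₃ ⟨hm₃, ⟨hF₃, hO₃, hi₃⟩, he₃, hj₃, hN₃, hP₄⟩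
        dsimp only at hm₃ hF₃ hO₃ hi₃ he₃ hP₄
        rw [hO₂] at hm₃
        rw [hF₂, hO₂] at hP₄
        -- Marking `j` as eliminated releases its constant weight 60, which pays for taking it from
        -- `L` and for the last test of the inner loop.
        have hpot := elimPotential_insert (W := 120 * d ^ 2) (N := s₃.N) hcur.1 hcur.2.1
        refine .block_cons (.act (.block_nil ⟨⟨⟨hF₃.trans hF₂, hO₃.trans hO₂, hi₃.trans hi₂⟩,
          ?_⟩, ?_⟩))
        · dsimp only
          rw [hj₃, he₃]
          exact hP₄.eliminate hiO hN₃
        · dsimp only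
          rw [hj₃, he₃]
          omega
    · rintro s₂ m₂ ⟨⟨hF₂, hO₂, hi₂⟩, hP₂⟩ hS₂ hm₂
      rw [hS₂] at hP₂
      refine .block_nil ⟨?_, hF₂, hO₂, hP₂.finish⟩
      dsimp only at hm₁
      rw [hsi] at hm₁
      dsimp only
      rw [he₁, hN₁] at hm₂
      rw [hsi]
      omega

open scoped Classical in
theorem runs_eliminate [Fintype V] (D : V → Finset U) {d : ℕ} (hd : ∀ i, (D i).card ≤ d)
    (h0 : 0 < d) (s : Memory V U) (hsymm : ∀ v, ∀ w ∈ s.N v, v ∈ s.N w) (hirr : ∀ v, v ∉ s.N v)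
    (hFN : ∀ v, ∀ w ∈ s.F v, w ∈ s.N v) (hnd : s.O.Nodup) (hmem : ∀ v, v ∈ s.O)
    (hO : s.O.Pairwise fun v w => Reach s.F v w ∨ Reach s.F w v → Reach s.F v w) :
    Runs (eliminate D) s fun _ m =>
      m ≤ ∑ v, (111 + 120 * d ^ 2 * (s.N v).card) + 20 := by
  have hd2 : 0 < d ^ 2 := by positivity
  have hlen : s.O.length ≤ Fintype.card V := hnd.length_le_card
  refine .block_cons (.bulk (.block_cons (.loop
    (fun s' => s'.F = s.F ∧ s'.O <:+ s.O ∧ BetweenPhases s.F s'.N s'.O s'.eliminated)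
    (fun s' => 50 * s'.O.length + elimPotential (120 * d ^ 2) s'.N s'.O s'.eliminated)
    ⟨rfl, List.suffix_rfl, hsymm, hirr, by simp, fun v w hw => .inl (hFN v w hw), ?_⟩ ?_ ?_)))
  · simp [hmem]
  · rintro s₁ ⟨hF, hsuf, hB⟩ hne
    obtain ⟨i, l, hil⟩ := List.exists_cons_of_ne_nil hne
    rw [hil] at hsuf hB
    have hil' : i ∉ l := (List.nodup_cons.1 (hsuf.sublist.nodup hnd)).1
    have hlsuf : l <:+ s.O := (List.suffix_cons i l).trans hsuf
    refine .block_cons (.first hil (.block_cons (.when (fun hi => ?_) fun hi =>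
      .block_nil ⟨⟨hF, ?_, ?_⟩, ?_⟩)))
    · dsimp only at hi
      refine (runs_phase D hd h0 (i := i) _ rfl (by exact hi) ?_ ?_ ?_).mono ?_
      · dsimp only
        rwa [hil, List.tail_cons]
      · dsimp only
        rw [hF, hil, List.tail_cons]
        exact fun v => hB.mem_of_reach hi hmem hO hsuf
      · dsimp only
        rwa [hF, hil, List.tail_cons]
      · rintro s₂ m ⟨hm, hF₂, hO₂, hB₂⟩
        dsimp only at hm hF₂ hO₂ hB₂
        rw [hil, List.tail_cons] at hm hO₂ hB₂
        rw [hF] at hF₂ hB₂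
        rw [hil, elimPotential_cons hil' hi, List.length_cons]
        refine .block_nil ⟨⟨hF₂, hO₂ ▸ hlsuf, hO₂ ▸ hB₂⟩, ?_⟩
        rw [hO₂]
        -- The scan of the neighbours of the root is paid by the root's own weight, released when it
        -- leaves `O`.
        have : 10 * (s₁.N i).card ≤ 120 * d ^ 2 * (s₁.N i).card := Nat.mul_le_mul_right _ (by omega)
        omega
    · dsimp only
      rwa [hil, List.tail_cons]
    · dsimp only at hi ⊢
      rw [hil, List.tail_cons]
      exact hB.skip (not_not.1 hi)
    · dsimp only
      rw [hil, List.tail_cons, List.length_cons]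
      have := elimPotential_le_cons (W := 120 * d ^ 2) (N := s₁.N) (O := l) (elim := s₁.eliminated)
        (i := i)
      omega
  · rintro s' m - - hm
    refine .block_nil ?_
    have : elimPotential (120 * d ^ 2) s.N s.O ∅ ≤ ∑ v, (60 + 120 * d ^ 2 * (s.N v).card) :=
      Finset.sum_le_sum_of_subset (Finset.subset_univ _)
    simp only [Finset.sum_add_distrib, Finset.sum_const, Finset.card_univ, smul_eq_mul]
      at hm this ⊢
    omega

/-! ### The cost of step 1, and both bounds in terms of the problem. -/

open scoped Classical in
theorem runs_findOrdering [Fintype V] (D : V → Finset U) {d : ℕ} (hd : ∀ i, (D i).card ≤ d)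
    (h0 : 0 < d) (s : Memory V U) (hsymm : ∀ v, ∀ w ∈ s.N v, v ∈ s.N w) :
    Runs (findOrdering D) s fun s' m =>
      m ≤ 100 * d ^ 2 * (∑ v, (s.N v).card) + 240 * Fintype.card V + 70 ∧
        s'.N = s.N ∧ s'.c = s.c ∧
        (∀ v w, w ∈ s'.F v ↔ w ∈ s.N v ∧ FunctionalOn D s.c v w) ∧
        (∀ v, v ∈ s'.O) ∧ OrderedComponents s'.F s'.O := by
  have hd2 : 0 < d ^ 2 := by positivity
  refine .block_cons ((runs_buildGraph D hd h0 s).mono ?_)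
  rintro s₁ m₁ ⟨hm₁, hN₁, hc₁, hF₁, hB₁⟩
  refine .block_cons ((runs_depthFirstSearch s₁).mono ?_)
  rintro s₂ m₂ ⟨hm₂, ⟨hN₂, hc₂, hF₂, hB₂⟩, hnd, hmem, hcl⟩
  refine .block_cons ((runs_collectComponents s₂ (by rwa [hF₂, hB₂]) hnd hmem
    (by rwa [hF₂])).mono ?_)
  rintro s₃ m₃ ⟨hm₃, ⟨hN₃, hc₃, hF₃, hB₃⟩, hO, hO'⟩
  refine .block_nil ⟨?_, hN₃.trans (hN₂.trans hN₁), hc₃.trans (hc₂.trans hc₁), ?_, hO, ?_⟩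
  · have hF : ∑ v, (s₁.F v).card ≤ ∑ v, (s.N v).card := Finset.sum_le_sum fun v _ =>
      Finset.card_le_card fun w hw => ((hF₁ v w).1 hw).1
    -- Functional predecessors are neighbours because the constraint graph is symmetric.
    have hB : ∑ v, (s₂.B v).card ≤ ∑ v, (s.N v).card := Finset.sum_le_sum fun v _ =>
      Finset.card_le_card fun w hw => by
        rw [hB₂] at hw
        exact hsymm _ _ ((hF₁ w v).1 ((hB₁ w v).1 hw)).1
    have hS : ∑ v, (s.N v).card ≤ d ^ 2 * ∑ v, (s.N v).card := Nat.le_mul_of_pos_left _ hd2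
    simp only [Finset.sum_add_distrib, Finset.sum_const, Finset.card_univ, smul_eq_mul,
      ← Finset.mul_sum] at hm₂ hm₃
    rw [mul_assoc] at hm₁ ⊢
    omega
  · rw [hF₃, hF₂]
    exact hF₁
  · rwa [hF₃]

end LinearElimination

open LinearElimination

section CSP

variable {V U : Type}

theorem Memory.Holds.symm {P : CSP V U} {s : Memory V U} (h : s.Holds P) (v : V) :
    ∀ w ∈ s.N v, v ∈ s.N w :=
  fun w hw => (h.1 w v).2 ((h.1 v w).1 hw).symm

theorem Memory.Holds.irrefl {P : CSP V U} {s : Memory V U} (h : s.Holds P) (v : V) : v ∉ s.N v :=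
  fun hv => P.G.irrefl ((h.1 v v).1 hv)

theorem Memory.Holds.sum_card [Fintype V] {P : CSP V U} {s : Memory V U} (h : s.Holds P) :
    ∑ v, (s.N v).card = 2 * P.e := by
  classical
  rw [CSP.e, Set.ncard_eq_toFinset_card', ← SimpleGraph.edgeFinset,
    ← SimpleGraph.sum_degrees_eq_twice_card_edges]
  refine Finset.sum_congr rfl fun v _ => ?_
  rw [← SimpleGraph.card_neighborFinset_eq_degree]
  congr 1
  ext w
  rw [SimpleGraph.mem_neighborFinset, h.1]

theorem Memory.Holds.functional_iff {P : CSP V U} {s : Memory V U} (h : s.Holds P) (v w : V) :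
    w ∈ s.N v ∧ FunctionalOn P.D s.c v w ↔ P.Functional v w := by
  rw [CSP.Functional, h.1]
  refine and_congr_right fun hvw => forall₂_congr fun a ha => forall₂_congr fun b hb =>
    forall₂_congr fun b' hb' => ?_
  rw [h.2 v w hvw a ha b hb, h.2 v w hvw a ha b' hb']

theorem Memory.RecordsFunctional.path_eq {P : CSP V U} {s : Memory V U}
    (h : s.RecordsFunctional P) : P.Path = Reach s.F := by
  have : P.Functional = fun v w => w ∈ s.F v := by
    funext v w
    exact propext (h v w).symm
  unfold CSP.Path
  rw [this]

/-- Inside a component paths exist in both directions; between components the topological order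
excludes the backward path, so only the forward one is left. -/
theorem CSP.IsTopologicalSequenceOfSCCs.isFunctionalEliminationOrdering {P : CSP V U} {O : List V}
    (h : P.IsTopologicalSequenceOfSCCs O) : P.IsFunctionalEliminationOrdering O := by
  obtain ⟨hnd, hmem, S, rfl, hS, hS'⟩ := h
  refine ⟨hnd, hmem, List.pairwise_flatten.2 ⟨fun K hK => ?_, hS'.imp ?_⟩⟩
  · refine List.Pairwise.imp_of_mem (R := fun _ _ => True) ?_ (List.pairwise_of_forall (by simp))
    exact fun {u v} hu hv _ _ => (((hS K hK).2 u hu v).1 hv).1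
  · exact fun {K K'} hKK' u hu v hv huv => huv.resolve_right (hKK' u hu v hv)

theorem LinearElimination.runs_findOrdering_of_holds [Fintype V] {P : CSP V U} {s : Memory V U}
    (h0 : 0 < P.d) (hs : s.Holds P) :
    Cmd.Runs (findOrdering P.D) s fun s' m =>
      m ≤ 200 * (P.e * P.d ^ 2) + 240 * Fintype.card V + 70 ∧
        s'.Holds P ∧ s'.RecordsFunctional P ∧
          P.IsFunctionalEliminationOrdering s'.O ∧ P.IsTopologicalSequenceOfSCCs s'.O := by
  have hd : ∀ i, (P.D i).card ≤ P.d := fun i =>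
    Finset.le_sup (f := fun i => (P.D i).card) (Finset.mem_univ i)
  refine (runs_findOrdering P.D hd h0 s hs.symm).mono ?_
  rintro s' m ⟨hm, hN, hc, hF, hO, hO'⟩
  have hR : s'.RecordsFunctional P := fun v w => (hF v w).trans (hs.functional_iff v w)
  have hT : P.IsTopologicalSequenceOfSCCs s'.O := by
    refine ⟨hO'.nodup, hO, ?_⟩
    rw [hR.path_eq]
    exact hO'.components
  refine ⟨?_, ?_, hR, hT.isFunctionalEliminationOrdering, hT⟩
  · rw [hs.sum_card] at hm
    linarith
  · rw [Memory.Holds, hN, hc]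
    exact hs

theorem LinearElimination.runs_eliminate_of_holds [Fintype V] {P : CSP V U} {s : Memory V U}
    (h0 : 0 < P.d) (hs : s.Holds P) (hF : s.RecordsFunctional P)
    (hO : P.IsFunctionalEliminationOrdering s.O) :
    Cmd.Runs (eliminate P.D) s fun _ m =>
      m ≤ 240 * (P.e * P.d ^ 2) + 111 * Fintype.card V + 20 := by
  have hd : ∀ i, (P.D i).card ≤ P.d := fun i =>
    Finset.le_sup (f := fun i => (P.D i).card) (Finset.mem_univ i)
  obtain ⟨hnd, hmem, hpw⟩ := hO
  rw [hF.path_eq] at hpw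
  refine (runs_eliminate P.D hd h0 s hs.symm hs.irrefl
    (fun v w hw => (hs.1 v w).2 ((hF v w).1 hw).1) hnd hmem hpw).mono fun s' m hm => ?_
  rw [Finset.sum_add_distrib, ← Finset.mul_sum, hs.sum_card, Finset.sum_const, Finset.card_univ,
    smul_eq_mul] at hm
  linarith

end CSP

theorem mainTheorem1 (κ : ℕ) : ∃ K : ℕ, ∀ (V U : Type) [Fintype V] (P : CSP V U),
    0 < P.e → 0 < P.d → Fintype.card V ≤ κ * P.e →
    -- the whole algorithm
    (∀ s : Memory V U, s.Holds P →
      Cmd.RunsWithin (linearElimination P.D) s (K * (P.e * P.d ^ 2)) fun _ => True) ∧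
    -- the first part of it, which finds a functional elimination ordering
    (∀ s : Memory V U, s.Holds P →
      Cmd.RunsWithin (LinearElimination.findOrdering P.D) s (K * (P.e * P.d ^ 2)) fun s' =>
        s'.Holds P ∧ s'.RecordsFunctional P ∧
          P.IsFunctionalEliminationOrdering s'.O ∧ P.IsTopologicalSequenceOfSCCs s'.O) ∧
    -- the elimination itself, from an arbitrary functional elimination ordering
    (∀ s : Memory V U, s.Holds P → s.RecordsFunctional P →
      P.IsFunctionalEliminationOrdering s.O →
      Cmd.RunsWithin (LinearElimination.eliminate P.D) s (K * (P.e * P.d ^ 2)) fun _ => True) := by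

  -- The two parts contribute `200 + 240` times `P.e * P.d ^ 2`, and `240 + 111` per variable, which
  -- `hn` converts into multiples of `κ`. Additive constants are absorbed because `P.e * P.d ^ 2` is
  -- at least 1.
  refine ⟨600 + 400 * κ, fun V U _ P he hd hn => ?_⟩
  have hed : P.e ≤ P.e * P.d ^ 2 := Nat.le_mul_of_pos_right _ (by positivity)
  have hκ : κ * P.e ≤ κ * (P.e * P.d ^ 2) := Nat.mul_le_mul_left _ hed
  have hK : (600 + 400 * κ) * (P.e * P.d ^ 2) =
      600 * (P.e * P.d ^ 2) + 400 * (κ * (P.e * P.d ^ 2)) := by ring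
  rw [hK]
  refine ⟨fun s hs => Cmd.Runs.runsWithin ?_, fun s hs => Cmd.Runs.runsWithin ?_,
    fun s hs hF hO => Cmd.Runs.runsWithin ?_⟩
  · refine .seq ((runs_findOrdering_of_holds hd hs).mono ?_)
    rintro s₁ m₁ ⟨hm₁, hs₁, hF₁, hO₁, -⟩
    refine (runs_eliminate_of_holds hd hs₁ hF₁ hO₁).mono fun s₂ m₂ hm₂ => ⟨?_, trivial⟩
    omega
  · refine (runs_findOrdering_of_holds hd hs).mono fun s₁ m₁ hm₁ => ⟨?_, hm₁.2⟩
    have := hm₁.1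
    omega
  · refine (runs_eliminate_of_holds hd hs hF hO).mono fun s₁ m₁ hm₁ => ⟨?_, trivial⟩
    omega
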